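/- A directed graph $E=(E^0,E^1,s_E,t_E)$ consists of a set $E^0$ of vertices, a set $E^1$ of edges and source and target maps $s_E,t_E:E^1\to E^0$ (no finiteness or countability is assumed). Let $\mathrm{FP}(E)$ be the set of its finite paths, vertices being the paths of length $0$, with source and target maps $s_{PE},t_{PE}$. For paths $x,x'$ write $x\preceq x'$ if $x$ is an initial subpath of $x'$, and $x\sim x'$ if $x\preceq x'$ or $x'\preceq x$. A vertex is regular if it emits at least one and only finitely many edges. A relation morphism $R:E\to F$ is a relation $R\subseteq \mathrm{FP}(E)\times\mathrm{FP}(F)$ such that $(x,y)\in R$ and $y\in F^0$ imply $x\in E^0$, and $(x,y)\in R$ implies $(s_{PE}(x),s_{PF}(y))\in R$ and $(t_{PE}(x),t_{PF}(y))\in R$. Put $R^{-1}(y)=\{x : (x,y)\in R\}$. With the composition of relations $S\circ R$ and the diagonal relations as identities, graphs and relation morphisms form a category $\mathsf{RG}$. Consider the following conditions on $R$: 1. $(x,y),(x',y')\in R$, $s_{PE}(x')=t_{PE}(x)$ and $s_{PF}(y')=t_{PF}(y)$ imply $(xx',yy')\in R$; 2. if $s_{PF}(y')=t_{PF}(y)$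 and $(\bar x,yy')\in R$, then $\bar x=xx'$ for some $x\in R^{-1}(y)$, $x'\in R^{-1}(y')$; 3. $R^{-1}(y)$ is finite for all $y\in\mathrm{FP}(F)$; 4. $R^{-1}(v)\cap R^{-1}(v')=\emptyset$ for distinct $v,v'\in F^0$; 5. for each $f\in F^1$ the map $t_{PE}:R^{-1}(f)\to R^{-1}(t_F(f))$ is bijective; 6. if $(x,f),(x',f')\in R$ with $f,f'\in F^1$ and $x\preceq x'$, then $(x,f)=(x',f')$; 7. if $v\in F^0$ is regular, $u\in R^{-1}(v)$ and $x\in\mathrm{FP}(E)$ starts at $u$, then there is $(x',f)\in R$ with $f\in F^1$, $s_F(f)=v$ and $x\sim x'$. Let $\mathsf{CRG}$ be the subcategory of $\mathsf{RG}$ of all graphs and all relation morphisms satisfying (1)-(6), and let $\mathsf{ARG}$ be the subcategory of all graphs and all relation morphisms satisfying (1)-(7). Let $C_{\mathbb C}(E)$ be the Cohn path $*$-algebra, i.e. the universal associative (not necessarily unital) complex algebra generated by $S_v$ ($v\in E^0$) and $S_e,S_{e^*}$ ($e\in E^1$) subject to $S_vS_w=\delta_{v,w}S_v$, $S_{s_E(e)}S_e=S_e=S_eS_{t_E(e)}$,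 $S_{t_E(e)}S_{e^*}=S_{e^*}=S_{e^*}S_{s_E(e)}$ and $S_{e^*}S_{e'}=\delta_{e,e'}S_{t_E(e)}$, with the involution $S_v^*=S_v$, $S_e^*=S_{e^*}$. The Leavitt path $*$-algebra $L_{\mathbb C}(E)$ is defined in the same way with the additional relations $S_v=\sum_{e\in s_E^{-1}(v)}S_eS_{e^*}$ for all regular $v$. For a path $x=e_1\cdots e_n$ with $n\ge 1$ put $S_x=S_{e_1}\cdots S_{e_n}$ and $S_{x^*}=(S_x)^*$; for a vertex $v$ regarded as a path of length $0$, $S_{v^*}=(S_v)^*=S_v$. The Toeplitz graph C*-algebra $\mathcal T(E)$ and the graph C*-algebra $C^*(E)$ are the universal enveloping C*-algebras of $C_{\mathbb C}(E)$ and of $L_{\mathbb C}(E)$, that is, the Hausdorff completions in the greatest C*-seminorm. Let C*-$\mathsf{Alg}$ be the category of (not necessarily unital) C*-algebras and $*$-homomorphisms. **Statement.** (a) For every $R:E\to F$ in $\mathsf{CRG}$ there is a unique $*$-homomorphism $R_C^*:C_{\mathbb C}(F)\to C_{\mathbb C}(E)$ with $$R_C^*(S_y)=\sum_{x\in R^{-1}(y)}S_x\quad(y\in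 F^0\cup F^1),\qquad R_C^*(S_{f^*})=\sum_{x\in R^{-1}(f)}S_{x^*}\quad(f\in F^1),$$ and there is a unique contravariant functor $\mathsf{CRG}\to$ C*-$\mathsf{Alg}$ given on objects by $E\mapsto\mathcal T(E)$ that sends each $R:E\to F$ to a $*$-homomorphism $\mathcal T(F)\to\mathcal T(E)$ compatible with $R_C^*$ under the canonical maps $C_{\mathbb C}(F)\to\mathcal T(F)$ and $C_{\mathbb C}(E)\to\mathcal T(E)$. (b) For every $R:E\to F$ in $\mathsf{ARG}$ there is a unique $*$-homomorphism $R_L^*:L_{\mathbb C}(F)\to L_{\mathbb C}(E)$ given by the same formulas, and there is a unique contravariant functor $\mathsf{ARG}\to$ C*-$\mathsf{Alg}$ given on objects by $E\mapsto C^*(E)$ that sends each $R:E\to F$ to a $*$-homomorphism $C^*(F)\to C^*(E)$ compatible with $R_L^*$ under the canonical maps $L_{\mathbb C}(F)\to C^*(F)$ and $L_{\mathbb C}(E)\to C^*(E)$. -/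

import Mathlib

open CategoryTheory

universe u v w

set_option linter.unusedSectionVars false
set_option linter.checkUnivs false

noncomputable section

namespace GraphRel

/-! ### Directed graphs and finite paths -/

/-- A directed graph (quiver): vertices `V`, edges `Edge`, source and target maps. -/
structure DGraph : Type (max (u + 1) (v + 1)) where
  /-- vertices -/
  V : Type u
  /-- edges -/
  Edge : Type v
  /-- source of an edge -/
  s : Edge → V
  /-- target of an edge -/
  t : Edge → V

namespace DGraph

/-- A vertex is regular if it emits at least one and only finitely many edges. -/
def IsRegular (E : DGraph.{u, v}) (a : E.V) : Prop :=
  {e : E.Edge | E.s e = a}.Nonempty ∧ {e : E.Edge | E.s e = a}.Finite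

/-- `E.IsWalk a l`: the consecutive edges of the list `l` form a walk that starts at `a`. -/
def IsWalk (E : DGraph.{u, v}) : E.V → List E.Edge → Prop
  | _, [] => True
  | a, e :: l => E.s e = a ∧ E.IsWalk (E.t e) l

/-- The final vertex of the walk along `l` starting at `a`. -/
def endpoint (E : DGraph.{u, v}) : E.V → List E.Edge → E.V
  | a, [] => a
  | _, e :: l => E.endpoint (E.t e) l

lemma isWalk_append (E : DGraph.{u, v}) (l l' : List E.Edge) : ∀ a : E.V,
    E.IsWalk a (l ++ l') ↔ E.IsWalk a l ∧ E.IsWalk (E.endpoint a l) l' := by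
  induction l with
  | nil => intro a; simp [IsWalk, endpoint]
  | cons e l ih => intro a; simp [IsWalk, endpoint, ih, and_assoc]

lemma endpoint_append (E : DGraph.{u, v}) (l l' : List E.Edge) : ∀ a : E.V,
    E.endpoint a (l ++ l') = E.endpoint (E.endpoint a l) l' := by
  induction l with
  | nil => intro a; simp [endpoint]
  | cons e l ih => intro a; simp [endpoint, ih]

end DGraph

/-- A finite path: a list of composable edges, together with its source (so that the paths of
length zero are exactly the vertices). -/
@[ext]
structure FinPath (E : DGraph.{u, v}) : Type (max u v) where
  /-- the source of the path -/
  src : E.V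
  /-- the edges of the path -/
  edges : List E.Edge
  isWalk : E.IsWalk src edges

namespace FinPath

variable {E : DGraph.{u, v}}

/-- The target of a path. -/
def tgt (x : FinPath E) : E.V := E.endpoint x.src x.edges

/-- A vertex as a path of length zero. -/
def ofVertex (a : E.V) : FinPath E := ⟨a, [], trivial⟩

/-- An edge as a path of length one. -/
def ofEdge (e : E.Edge) : FinPath E := ⟨E.s e, [e], rfl, trivial⟩

/-- Concatenation of composable paths. -/
def concat (x x' : FinPath E) (h : x.tgt = x'.src) : FinPath E :=
  ⟨x.src, x.edges ++ x'.edges, by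
    rw [DGraph.isWalk_append]
    refine ⟨x.isWalk, ?_⟩
    have := x'.isWalk
    rw [← h] at this
    exact this⟩

/-- `x` is an initial subpath of `x'`. -/
def IsInitial (x x' : FinPath E) : Prop := ∃ (z : FinPath E) (h : x.tgt = z.src), x.concat z h = x'

/-- Two paths are comparable if one of them is an initial subpath of the other. -/
def Comparable (x x' : FinPath E) : Prop := IsInitial x x' ∨ IsInitial x' x

@[simp] lemma src_ofVertex (a : E.V) : (ofVertex a).src = a := rfl
@[simp] lemma tgt_ofVertex (a : E.V) : (ofVertex a).tgt = a := rfl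
@[simp] lemma edges_ofVertex (a : E.V) : (ofVertex a).edges = [] := rfl
@[simp] lemma src_ofEdge (e : E.Edge) : (ofEdge e).src = E.s e := rfl
@[simp] lemma tgt_ofEdge (e : E.Edge) : (ofEdge e).tgt = E.t e := rfl
@[simp] lemma edges_ofEdge (e : E.Edge) : (ofEdge e).edges = [e] := rfl
@[simp] lemma src_concat (x x' : FinPath E) (h : x.tgt = x'.src) : (x.concat x' h).src = x.src :=
  rfl
@[simp] lemma edges_concat (x x' : FinPath E) (h : x.tgt = x'.src) :
    (x.concat x' h).edges = x.edges ++ x'.edges := rfl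
@[simp] lemma tgt_concat (x x' : FinPath E) (h : x.tgt = x'.src) :
    (x.concat x' h).tgt = x'.tgt := by
  simp only [tgt, src_concat, edges_concat, DGraph.endpoint_append]
  have h' : E.endpoint x.src x.edges = x'.src := h
  rw [h']

lemma ofVertex_injective : Function.Injective (ofVertex (E := E)) := fun _ _ h =>
  congrArg FinPath.src h

/-- A path of length zero is a vertex. -/
lemma eq_ofVertex {x : FinPath E} (h : x.edges = []) : x = ofVertex x.src := by
  ext1 <;> simp [h]

lemma tgt_eq_src {x : FinPath E} (h : x.edges = []) : x.tgt = x.src := by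
  simp [tgt, h, DGraph.endpoint]

/-- A path of positive length is its first edge followed by a shorter path. -/
lemma exists_eq_cons {x : FinPath E} {e : E.Edge} {l : List E.Edge} (h : x.edges = e :: l) :
    ∃ (z : FinPath E) (hz : (ofEdge e).tgt = z.src), x = (ofEdge e).concat z hz ∧ z.edges = l := by
  have hw := x.isWalk
  rw [h] at hw
  refine ⟨⟨E.t e, l, hw.2⟩, rfl, ?_, rfl⟩
  ext1
  · exact hw.1.symm
  · rw [h]; rfl

/-- Splitting a path along a splitting of its list of edges. -/
lemma exists_eq_append {x : FinPath E} {l l' : List E.Edge} (h : x.edges = l ++ l') :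
    ∃ (y z : FinPath E) (hz : y.tgt = z.src),
      y.concat z hz = x ∧ y.edges = l ∧ z.edges = l' := by
  have hw := x.isWalk
  rw [h, DGraph.isWalk_append] at hw
  refine ⟨⟨x.src, l, hw.1⟩, ⟨E.endpoint x.src l, l', hw.2⟩, rfl, ?_, rfl, rfl⟩
  ext1
  · rfl
  · rw [h]; rfl

lemma isInitial_iff {x x' : FinPath E} :
    IsInitial x x' ↔ x.src = x'.src ∧ x.edges <+: x'.edges := by
  constructor
  · rintro ⟨z, h, rfl⟩
    exact ⟨rfl, List.prefix_append _ _⟩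
  · rintro ⟨hs, l, hl⟩
    obtain ⟨y, z, hz, hx, hy, -⟩ := exists_eq_append hl.symm
    have : x = y := by
      ext1
      · rw [hs, ← hx]; rfl
      · exact hy.symm
    subst this
    exact ⟨z, hz, hx⟩

lemma IsInitial.refl (x : FinPath E) : IsInitial x x :=
  isInitial_iff.2 ⟨rfl, List.prefix_rfl⟩

lemma IsInitial.trans {x y z : FinPath E} (h : IsInitial x y) (h' : IsInitial y z) :
    IsInitial x z := by
  rw [isInitial_iff] at *
  exact ⟨h.1.trans h'.1, h.2.trans h'.2⟩

lemma IsInitial.antisymm {x y : FinPath E} (h : IsInitial x y) (h' : IsInitial y x) : x = y := by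
  rw [isInitial_iff] at *
  ext1
  · exact h.1
  · exact h.2.eq_of_length_le h'.2.length_le

/-- Two initial subpaths of one path are comparable. -/
lemma comparable_of_isInitial {x y z : FinPath E} (h : IsInitial x z) (h' : IsInitial y z) :
    Comparable x y := by
  simp only [Comparable, isInitial_iff] at *
  rcases List.prefix_or_prefix_of_prefix h.2 h'.2 with h1 | h1
  · exact Or.inl ⟨h.1.trans h'.1.symm, h1⟩
  · exact Or.inr ⟨h'.1.trans h.1.symm, h1⟩

lemma Comparable.src_eq {x y : FinPath E} (h : Comparable x y) : x.src = y.src := by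
  rcases h with h | h
  · exact (isInitial_iff.1 h).1
  · exact (isInitial_iff.1 h).1.symm

lemma Comparable.symm {x y : FinPath E} (h : Comparable x y) : Comparable y x := Or.symm h

lemma isInitial_concat (x z : FinPath E) (h : x.tgt = z.src) : IsInitial x (x.concat z h) :=
  ⟨z, h, rfl⟩

lemma isInitial_concat_concat {x y z : FinPath E} (h : x.tgt = y.src) (h' : x.tgt = z.src) :
    IsInitial (x.concat y h) (x.concat z h') ↔ IsInitial y z := by
  simp [isInitial_iff, List.prefix_append_right_inj, ← h, ← h']

lemma comparable_concat_concat {x y z : FinPath E} (h : x.tgt = y.src) (h' : x.tgt = z.src) :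
    Comparable (x.concat y h) (x.concat z h') ↔ Comparable y z := by
  simp [Comparable, isInitial_concat_concat]

lemma isInitial_ofVertex {a : E.V} {x : FinPath E} (h : a = x.src) :
    IsInitial (ofVertex a) x := isInitial_iff.2 ⟨h, List.nil_prefix⟩

lemma eq_of_isInitial_of_nil {x x' : FinPath E} (h : IsInitial x x') (h' : x'.edges = []) :
    x = x' := by
  rw [isInitial_iff, h', List.prefix_nil] at h
  ext1
  · exact h.1
  · rw [h.2, h']

/-- The first factors of comparable concatenations are comparable. -/
lemma Comparable.left {x z x' z' : FinPath E} {h : x.tgt = z.src} {h' : x'.tgt = z'.src}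
    (hc : Comparable (x.concat z h) (x'.concat z' h')) : Comparable x x' := by
  rcases hc with hc | hc
  · exact comparable_of_isInitial ((isInitial_concat x z h).trans hc) (isInitial_concat x' z' h')
  · exact comparable_of_isInitial (isInitial_concat x z h) ((isInitial_concat x' z' h').trans hc)

end FinPath

open FinPath

/-! ### Relation morphisms -/

/-- A relation morphism `E → F`: a relation between the finite paths of `E` and of `F` such that
only vertices are related to vertices and that preserves sources and targets. -/
@[ext]
structure RelMorphism (E F : DGraph.{u, v}) : Type (max u v) where
  /-- `rel x y` means that `(x, y)` belongs to the relation -/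
  rel : FinPath E → FinPath F → Prop
  vertex_of_vertex : ∀ (x : FinPath E) (b : F.V), rel x (ofVertex b) → ∃ a : E.V, x = ofVertex a
  source : ∀ (x : FinPath E) (y : FinPath F), rel x y → rel (ofVertex x.src) (ofVertex y.src)
  target : ∀ (x : FinPath E) (y : FinPath F), rel x y → rel (ofVertex x.tgt) (ofVertex y.tgt)

namespace RelMorphism

variable {E F G : DGraph.{u, v}}

/-- The identity (diagonal) relation. -/
def id (E : DGraph.{u, v}) : RelMorphism E E where
  rel x y := x = y
  vertex_of_vertex _ b h := ⟨b, h⟩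
  source := by rintro x _ rfl; rfl
  target := by rintro x _ rfl; rfl

/-- The composition `S ∘ R` of the relations `R : E → F` and `S : F → G`. -/
def comp (R : RelMorphism E F) (S : RelMorphism F G) : RelMorphism E G where
  rel x z := ∃ y, R.rel x y ∧ S.rel y z
  vertex_of_vertex := by
    rintro x c ⟨y, hx, hy⟩
    obtain ⟨b, rfl⟩ := S.vertex_of_vertex y c hy
    exact R.vertex_of_vertex x b hx
  source := by
    rintro x z ⟨y, hx, hy⟩
    exact ⟨_, R.source x y hx, S.source y z hy⟩
  target := by
    rintro x z ⟨y, hx, hy⟩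
    exact ⟨_, R.target x y hx, S.target y z hy⟩

/-- The relation preimage of a path. -/
def preimage (R : RelMorphism E F) (y : FinPath F) : Set (FinPath E) := {x | R.rel x y}

/-- Multiplicativity. -/
def IsMult (R : RelMorphism E F) : Prop :=
  ∀ (x x' : FinPath E) (y y' : FinPath F) (hx : x.tgt = x'.src) (hy : y.tgt = y'.src),
    R.rel x y → R.rel x' y' → R.rel (x.concat x' hx) (y.concat y' hy)

/-- Decomposability. -/
def IsDecomposable (R : RelMorphism E F) : Prop :=
  ∀ (y y' : FinPath F) (hy : y.tgt = y'.src) (z : FinPath E), R.rel z (y.concat y' hy) →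
    ∃ (x x' : FinPath E) (hx : x.tgt = x'.src), R.rel x y ∧ R.rel x' y' ∧ x.concat x' hx = z

/-- Every path has only finitely many preimages. -/
def IsProper (R : RelMorphism E F) : Prop := ∀ y : FinPath F, (R.preimage y).Finite

/-- Different vertices have disjoint preimages. -/
def IsVertexDisjoint (R : RelMorphism E F) : Prop :=
  ∀ b b' : F.V, b ≠ b' → Disjoint (R.preimage (ofVertex b)) (R.preimage (ofVertex b'))

/-- For each edge `f`, the target map is injective on `R⁻¹(f)`. -/
def IsTargetInjective (R : RelMorphism E F) : Prop :=
  ∀ f : F.Edge, Set.InjOn FinPath.tgt (R.preimage (ofEdge f))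

/-- For each edge `f`, the target map `R⁻¹(f) → R⁻¹(t(f))` is surjective. -/
def IsTargetSurjective (R : RelMorphism E F) : Prop :=
  ∀ f : F.Edge, Set.SurjOn (fun x => ofVertex x.tgt) (R.preimage (ofEdge f))
    (R.preimage (ofVertex (F.t f)))

/-- `(x, f), (x', f') ∈ R` with edges `f`, `f'` and `x` an initial subpath of `x'` implies
`(x, f) = (x', f')`. -/
def IsMonotone (R : RelMorphism E F) : Prop :=
  ∀ (x x' : FinPath E) (f f' : F.Edge), R.rel x (ofEdge f) → R.rel x' (ofEdge f') →
    IsInitial x x' → x = x' ∧ f = f'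

/-- For every regular vertex `b` of `F`, every `a ∈ R⁻¹(b)` and every path `x` starting at `a`
there is `(x', f) ∈ R` with `f` an edge starting at `b` and `x'` comparable to `x`. -/
def IsRegular (R : RelMorphism E F) : Prop :=
  ∀ (b : F.V) (a : E.V) (x : FinPath E), F.IsRegular b → R.rel (ofVertex a) (ofVertex b) →
    x.src = a → ∃ (x' : FinPath E) (f : F.Edge), R.rel x' (ofEdge f) ∧ F.s f = b ∧ Comparable x x'

/-- The relation morphisms of the path-algebra category `PRG`. -/
structure IsPRG (R : RelMorphism E F) : Prop where
  mult : R.IsMult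
  decomposable : R.IsDecomposable
  proper : R.IsProper
  vertexDisjoint : R.IsVertexDisjoint
  targetInjective : R.IsTargetInjective

/-- The relation morphisms of the Cohn-Toeplitz category `CRG`. -/
structure IsCRG (R : RelMorphism E F) : Prop extends R.IsPRG where
  targetSurjective : R.IsTargetSurjective
  monotone : R.IsMonotone

/-- Admissible relation morphisms. -/
structure IsAdmissible (R : RelMorphism E F) : Prop extends R.IsCRG where
  regular : R.IsRegular

end RelMorphism

/-- The category `RG` of directed graphs and relation morphisms. -/
instance : Category DGraph.{u, v} where
  Hom E F := RelMorphism E F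
  id E := RelMorphism.id E
  comp R S := R.comp S
  id_comp R := by
    apply RelMorphism.ext
    funext x y
    simp [RelMorphism.comp, RelMorphism.id]
  comp_id R := by
    apply RelMorphism.ext
    funext x y
    simp [RelMorphism.comp, RelMorphism.id]
  assoc R S T := by
    apply RelMorphism.ext
    funext x y
    simp only [RelMorphism.comp, eq_iff_iff]
    constructor
    · rintro ⟨z, ⟨w, h1, h2⟩, h3⟩
      exact ⟨w, h1, z, h2, h3⟩
    · rintro ⟨w, h1, z, h2, h3⟩
      exact ⟨z, ⟨w, h1, h2⟩, h3⟩

/-! ### Closure under composition -/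

namespace RelMorphism

variable {E F G : DGraph.{u, v}}

lemma nil_of_nil (R : RelMorphism E F) {x : FinPath E} {y : FinPath F} (h : R.rel x y)
    (hy : y.edges = []) : x.edges = [] := by
  rw [eq_ofVertex hy] at h
  obtain ⟨a, rfl⟩ := R.vertex_of_vertex _ _ h
  rfl

lemma IsVertexDisjoint.eq {R : RelMorphism E F} (hR : R.IsVertexDisjoint) {x : FinPath E}
    {b b' : F.V} (h : R.rel x (ofVertex b)) (h' : R.rel x (ofVertex b')) : b = b' := by
  by_contra hne
  exact Set.disjoint_left.1 (hR b b' hne) h h'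

lemma id_isAdmissible (E : DGraph.{u, v}) : (id E).IsAdmissible where
  mult := by rintro x x' _ _ hx hy rfl rfl; rfl
  decomposable := by rintro y y' hy _ rfl; exact ⟨y, y', hy, rfl, rfl, rfl⟩
  proper y := by simp [preimage, id]
  vertexDisjoint b b' h := by
    rw [Set.disjoint_left]
    intro x hx hx'
    exact h (ofVertex_injective (Eq.trans (Eq.symm hx) hx'))
  targetInjective f x hx x' hx' _ := Eq.trans hx hx'.symm
  targetSurjective := by
    rintro f _ rfl
    exact ⟨ofEdge f, rfl, rfl⟩
  monotone := by
    rintro _ _ f f' rfl rfl h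
    have h1 := (isInitial_iff.1 h).2.eq_of_length (by simp)
    have h2 : f = f' := by simpa using h1
    subst h2
    exact ⟨rfl, rfl⟩
  regular := by
    rintro b a x hb hab rfl
    have hb' : x.src = b := ofVertex_injective hab
    rcases hl : x.edges with _ | ⟨e, l⟩
    · obtain ⟨e, he⟩ := hb.1
      refine ⟨ofEdge e, e, rfl, he, Or.inl ?_⟩
      rw [eq_ofVertex hl]
      exact isInitial_ofVertex (hb'.trans (Eq.symm he))
    · obtain ⟨z, hz, rfl, -⟩ := exists_eq_cons hl
      exact ⟨ofEdge e, e, rfl, hb', Or.inr (isInitial_concat _ _ _)⟩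

/-- Target injectivity extends to preimages of arbitrary paths. -/
lemma IsPRG.eq_of_tgt {R : RelMorphism E F} (hR : R.IsPRG) {y : FinPath F} :
    ∀ {x x' : FinPath E}, R.rel x y → R.rel x' y → x.tgt = x'.tgt → x = x' := by
  induction hn : y.edges generalizing y with
  | nil =>
    intro x x' hx hx' h
    have h1 := R.nil_of_nil hx hn
    have h2 := R.nil_of_nil hx' hn
    rw [tgt_eq_src h1, tgt_eq_src h2] at h
    rw [eq_ofVertex h1, eq_ofVertex h2, h]
  | cons f l ih =>
    intro x x' hx hx' h
    obtain ⟨z, hz, rfl, hl⟩ := exists_eq_cons hn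
    obtain ⟨x1, x2, h12, hx1, hx2, rfl⟩ := hR.decomposable _ _ hz _ hx
    obtain ⟨x1', x2', h12', hx1', hx2', rfl⟩ := hR.decomposable _ _ hz _ hx'
    simp only [tgt_concat] at h
    obtain rfl := ih hl hx2 hx2' h
    obtain rfl := hR.targetInjective f hx1 hx1' (h12.trans h12'.symm)
    rfl

/-- Target surjectivity extends to arbitrary paths. -/
lemma IsCRG.exists_tgt {R : RelMorphism E F} (hR : R.IsCRG) {y : FinPath F} :
    ∀ {a : E.V}, R.rel (ofVertex a) (ofVertex y.tgt) → ∃ x, R.rel x y ∧ x.tgt = a := by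
  induction hn : y.edges generalizing y with
  | nil =>
    intro a h
    rw [tgt_eq_src hn, ← eq_ofVertex hn] at h
    exact ⟨_, h, rfl⟩
  | cons f l ih =>
    intro a h
    obtain ⟨z, hz, rfl, hl⟩ := exists_eq_cons hn
    rw [tgt_concat] at h
    obtain ⟨x2, hx2, rfl⟩ := ih hl h
    have h3 := R.source _ _ hx2
    rw [← hz] at h3
    obtain ⟨x1, hx1, h1⟩ := hR.targetSurjective f h3
    have h1' : x1.tgt = x2.src := ofVertex_injective h1
    exact ⟨x1.concat x2 h1', hR.mult _ _ _ _ h1' hz hx1 hx2, tgt_concat _ _ _⟩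

/-- Comparable paths are related to comparable paths only. -/
lemma IsCRG.comparable {R : RelMorphism E F} (hR : R.IsCRG) {y : FinPath F} :
    ∀ {y' : FinPath F} {x x' : FinPath E}, R.rel x y → R.rel x' y' → Comparable x x' →
      Comparable y y' := by
  induction hn : y.edges generalizing y with
  | nil =>
    intro y' x x' hx hx' h
    left
    rw [eq_ofVertex hn]
    apply isInitial_ofVertex
    have h1 := R.source _ _ hx
    rw [h.src_eq] at h1
    exact hR.vertexDisjoint.eq h1 (R.source _ _ hx')
  | cons f l ih =>
    intro y' x x' hx hx' h
    rcases hn' : y'.edges with _ | ⟨f', l'⟩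
    · right
      rw [eq_ofVertex hn']
      apply isInitial_ofVertex
      have h1 := R.source _ _ hx
      rw [h.src_eq] at h1
      exact hR.vertexDisjoint.eq (R.source _ _ hx') h1
    · obtain ⟨z, hz, rfl, hl⟩ := exists_eq_cons hn
      obtain ⟨z', hz', rfl, hl'⟩ := exists_eq_cons hn'
      obtain ⟨x1, x2, h12, hx1, hx2, rfl⟩ := hR.decomposable _ _ hz _ hx
      obtain ⟨x1', x2', h12', hx1', hx2', rfl⟩ := hR.decomposable _ _ hz' _ hx'
      have h1 : x1 = x1' ∧ f = f' := by
        rcases h.left with h1 | h1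
        · exact hR.monotone _ _ _ _ hx1 hx1' h1
        · exact (hR.monotone _ _ _ _ hx1' hx1 h1).imp Eq.symm Eq.symm
      obtain ⟨rfl, rfl⟩ := h1
      rw [comparable_concat_concat] at h ⊢
      exact ih hl hx2 hx2' h

/-- The preimages of one path are pairwise incomparable. -/
lemma IsCRG.eq_of_isInitial {R : RelMorphism E F} (hR : R.IsCRG) {y : FinPath F} :
    ∀ {x x' : FinPath E}, R.rel x y → R.rel x' y → IsInitial x x' → x = x' := by
  induction hn : y.edges generalizing y with
  | nil =>
    intro x x' hx hx' h
    exact eq_of_isInitial_of_nil h (R.nil_of_nil hx' hn)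
  | cons f l ih =>
    intro x x' hx hx' h
    obtain ⟨z, hz, rfl, hl⟩ := exists_eq_cons hn
    obtain ⟨x1, x2, h12, hx1, hx2, rfl⟩ := hR.decomposable _ _ hz _ hx
    obtain ⟨x1', x2', h12', hx1', hx2', rfl⟩ := hR.decomposable _ _ hz _ hx'
    have h1 : x1 = x1' := by
      rcases Comparable.left (Or.inl h) with h1 | h1
      · exact (hR.monotone _ _ _ _ hx1 hx1' h1).1
      · exact (hR.monotone _ _ _ _ hx1' hx1 h1).1.symm
    subst h1
    rw [isInitial_concat_concat] at h
    obtain rfl := ih hl hx2 hx2' h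
    rfl

lemma IsCRG.comp {R : RelMorphism E F} {S : RelMorphism F G} (hR : R.IsCRG) (hS : S.IsCRG) :
    (R.comp S).IsCRG where
  mult := by
    rintro x x' z z' hx hz ⟨y, hxy, hyz⟩ ⟨y', hxy', hyz'⟩
    have h1 := R.target _ _ hxy
    rw [hx] at h1
    have h2 : y.tgt = y'.src := hR.vertexDisjoint.eq h1 (R.source _ _ hxy')
    exact ⟨y.concat y' h2, hR.mult _ _ _ _ hx h2 hxy hxy', hS.mult _ _ _ _ h2 hz hyz hyz'⟩
  decomposable := by
    rintro z z' hz x ⟨y, hxy, hyz⟩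
    obtain ⟨y1, y2, hy, hy1, hy2, rfl⟩ := hS.decomposable _ _ hz _ hyz
    obtain ⟨x1, x2, hx, hx1, hx2, rfl⟩ := hR.decomposable _ _ hy _ hxy
    exact ⟨x1, x2, hx, ⟨y1, hx1, hy1⟩, ⟨y2, hx2, hy2⟩, rfl⟩
  proper z := by
    refine ((hS.proper z).biUnion fun y _ => hR.proper y).subset ?_
    rintro x ⟨y, hxy, hyz⟩
    exact Set.mem_biUnion (show y ∈ S.preimage z from hyz) hxy
  vertexDisjoint := by
    intro c c' hne
    rw [Set.disjoint_left]
    rintro x ⟨y, hxy, hyz⟩ ⟨y', hxy', hyz'⟩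
    obtain ⟨b, rfl⟩ := S.vertex_of_vertex _ _ hyz
    obtain ⟨b', rfl⟩ := S.vertex_of_vertex _ _ hyz'
    obtain rfl := hR.vertexDisjoint.eq hxy hxy'
    exact hne (hS.vertexDisjoint.eq hyz hyz')
  targetInjective := by
    rintro g x ⟨y, hxy, hyz⟩ x' ⟨y', hxy', hyz'⟩ h
    have h1 := R.target _ _ hxy
    rw [h] at h1
    obtain rfl := hS.targetInjective g hyz hyz'
      (hR.vertexDisjoint.eq h1 (R.target _ _ hxy'))
    exact hR.toIsPRG.eq_of_tgt hxy hxy' h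
  targetSurjective := by
    rintro g x ⟨y, hxy, hyz⟩
    obtain ⟨y', hy', rfl⟩ := hS.targetSurjective g hyz
    obtain ⟨a, rfl⟩ := R.vertex_of_vertex _ _ hxy
    obtain ⟨x', hx', rfl⟩ := hR.exists_tgt hxy
    exact ⟨x', ⟨y', hx', hy'⟩, rfl⟩
  monotone := by
    rintro x x' g g' ⟨y, hxy, hyz⟩ ⟨y', hxy', hyz'⟩ h
    have h1 : y = y' ∧ g = g' := by
      rcases hR.comparable hxy hxy' (Or.inl h) with h1 | h1
      · exact hS.monotone _ _ _ _ hyz hyz' h1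
      · exact (hS.monotone _ _ _ _ hyz' hyz h1).imp Eq.symm Eq.symm
    obtain ⟨rfl, rfl⟩ := h1
    exact ⟨hR.eq_of_isInitial hxy hxy' h, rfl⟩

/-- The paths from `b` that are related to edges starting at `c`. -/
def frontier (R : RelMorphism E F) (c : F.V) (a : E.V) : Set (FinPath E) :=
  {x | x.src = a ∧ ∃ f, R.rel x (ofEdge f) ∧ F.s f = c}

/-- A proper initial subpath of an element of the frontier ends in a regular vertex. -/
lemma IsAdmissible.regular_tgt {R : RelMorphism E F} (hR : R.IsAdmissible) {c : F.V} {a : E.V}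
    (hc : F.IsRegular c) (hac : R.rel (ofVertex a) (ofVertex c)) {x0 x : FinPath E}
    (hx : x ∈ R.frontier c a) (h0 : IsInitial x0 x) (hne : x0 ≠ x) : E.IsRegular x0.tgt := by
  obtain ⟨z, hz, rfl⟩ := h0
  constructor
  · rcases hl : z.edges with _ | ⟨e, l⟩
    · exfalso
      apply hne
      ext1 <;> simp [hl]
    · obtain ⟨z', hz', rfl, -⟩ := exists_eq_cons hl
      exact ⟨e, hz.symm⟩
  · have hfin : (R.frontier c a).Finite := by
      refine (hc.2.biUnion fun f _ => hR.proper (ofEdge f)).subset ?_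
      rintro x ⟨-, f, hf, hs⟩
      exact Set.mem_biUnion (show f ∈ {e | F.s e = c} from hs) hf
    have hfin' := hfin.image (fun y : FinPath E => y.edges[x0.edges.length]?)
    refine Set.Finite.of_finite_image (f := some) (hfin'.subset ?_)
      (Option.some_injective _).injOn
    rintro _ ⟨e, he, rfl⟩
    have he' : x0.tgt = (ofEdge e).src := Eq.symm he
    obtain ⟨-, f0, hf0, hs0⟩ := And.intro hx.1 hx.2
    obtain ⟨y, f, hf, hs, hcmp⟩ := hR.regular c a (x0.concat (ofEdge e) he') hc hac hx.1
    have hini : IsInitial (x0.concat (ofEdge e) he') y := by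
      rcases hcmp with h1 | h1
      · exact h1
      · by_cases hy : y = x0.concat (ofEdge e) he'
        · rw [hy]; exact IsInitial.refl _
        · exfalso
          have h2 : IsInitial y x0 := by
            rw [isInitial_iff] at h1 ⊢
            refine ⟨h1.1, ?_⟩
            rcases List.prefix_concat_iff.1 h1.2 with h3 | h3
            · exact absurd (FinPath.ext h1.1 h3) hy
            · exact h3
          have h3 := (hR.monotone _ _ _ _ hf hf0 (h2.trans (isInitial_concat _ _ hz))).1
          exact hne ((isInitial_concat _ _ hz).antisymm (h3 ▸ h2))
    refine ⟨y, ⟨?_, f, hf, hs⟩, ?_⟩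
    · rw [← (isInitial_iff.1 hini).1]; exact hx.1
    · obtain ⟨l, hl⟩ := (isInitial_iff.1 hini).2
      simp [← hl]

lemma IsAdmissible.comp {R : RelMorphism E F} {S : RelMorphism F G} (hR : R.IsAdmissible)
    (hS : S.IsAdmissible) : (R.comp S).IsAdmissible where
  toIsCRG := hR.toIsCRG.comp hS.toIsCRG
  regular := by
    rintro c a x hc ⟨y, hay, hyc⟩ hxa
    obtain ⟨b, rfl⟩ := S.vertex_of_vertex _ _ hyc
    have hfin : (S.frontier c b).Finite := by
      refine (hc.2.biUnion fun f _ => hS.proper (ofEdge f)).subset ?_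
      rintro x ⟨-, f, hf, hs⟩
      exact Set.mem_biUnion (show f ∈ {e | G.s e = c} from hs) hf
    obtain ⟨N, hN⟩ := (hfin.image fun y => y.edges.length).bddAbove
    have key : ∀ (n : ℕ) (x0 : FinPath E) (y0 y : FinPath F), y0.edges.length + n = N + 1 →
        R.rel x0 y0 → Comparable x x0 → y ∈ S.frontier c b → IsInitial y0 y →
        ∃ x' y', R.rel x' y' ∧ Comparable x x' ∧ y' ∈ S.frontier c b := by
      intro n
      induction n with
      | zero =>
        intro x0 y0 y hlen _ _ hy hini
        exfalso
        have h1 : y.edges.length ≤ N := hN ⟨y, hy, rfl⟩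
        have h2 := (isInitial_iff.1 hini).2.length_le
        omega
      | succ n ih =>
        intro x0 y0 y hlen hxy hcmp hy hini
        by_cases hne : y0 = y
        · subst hne
          exact ⟨x0, y0, hxy, hcmp, hy⟩
        have hreg := hS.regular_tgt hc hyc hy hini hne
        have hstep : ∃ (x' : FinPath E) (f : F.Edge) (hx' : x0.tgt = x'.src),
            R.rel x' (ofEdge f) ∧ F.s f = y0.tgt ∧ Comparable x (x0.concat x' hx') := by
          rcases hcmp with h1 | h1
          · obtain ⟨x', f, hf, hs, hc'⟩ := hR.regular y0.tgt x0.tgt (ofVertex x0.tgt) hreg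
              (R.target _ _ hxy) rfl
            exact ⟨x', f, hc'.src_eq, hf, hs, Or.inl (h1.trans (isInitial_concat _ _ _))⟩
          · obtain ⟨x1, hx1, rfl⟩ := h1
            obtain ⟨x', f, hf, hs, hc'⟩ := hR.regular y0.tgt x0.tgt x1 hreg
              (R.target _ _ hxy) hx1.symm
            exact ⟨x', f, hx1.trans hc'.src_eq, hf, hs,
              (comparable_concat_concat _ _).2 hc'⟩
        obtain ⟨x', f, hx', hf, hs, hc'⟩ := hstep
        have hs' : y0.tgt = (ofEdge f).src := hs.symm
        have hy0 : y0.src = b := ((isInitial_iff.1 hini).1).trans hy.1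
        obtain ⟨y1, g, hg, hgs, hcy⟩ := hS.regular c b (y0.concat (ofEdge f) hs') hc hyc hy0
        have hini' : IsInitial (y0.concat (ofEdge f) hs') y1 := by
          rcases hcy with h1 | h1
          · exact h1
          · by_cases hy : y1 = y0.concat (ofEdge f) hs'
            · rw [hy]; exact IsInitial.refl _
            · exfalso
              have h2 : IsInitial y1 y0 := by
                rw [isInitial_iff] at h1 ⊢
                refine ⟨h1.1, ?_⟩
                rcases List.prefix_concat_iff.1 h1.2 with h3 | h3
                · exact absurd (FinPath.ext h1.1 h3) hy
                · exact h3
              rename_i hyfr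
              obtain ⟨-, f0, hf0, hs0⟩ := And.intro hyfr.1 hyfr.2
              have h3 := (hS.monotone _ _ _ _ hg hf0 (h2.trans hini)).1
              exact hne (hini.antisymm (h3 ▸ h2))
        refine ih (x0.concat x' hx') (y0.concat (ofEdge f) hs') y1 ?_
          (hR.mult _ _ _ _ hx' hs' hxy hf) hc' ⟨?_, g, hg, hgs⟩ hini'
        · simp; omega
        · rw [← (isInitial_iff.1 hini').1]; exact hy0
    obtain ⟨y0, g0, hg0, hs0, hc0⟩ := hS.regular c b (ofVertex b) hc hyc rfl
    have hsrc : y0.src = b := hc0.src_eq.symm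
    obtain ⟨x', y', hxy', hcmp, -, g, hg, hgs⟩ := key (N + 1) (ofVertex a) (ofVertex b) y0
      (by simp) hay (Or.inr (isInitial_ofVertex hxa.symm)) ⟨hsrc, g0, hg0, hs0⟩
      (isInitial_ofVertex hsrc.symm)
    exact ⟨x', g, ⟨y', hxy', hg⟩, hgs, hcmp⟩

end RelMorphism

/-- The morphisms of `CRG` as a property of the morphisms of `RG`. -/
def isCRG : MorphismProperty DGraph.{u, v} := fun _ _ R => RelMorphism.IsCRG R

/-- Admissibility as a property of the morphisms of `RG`. -/
def isAdmissible : MorphismProperty DGraph.{u, v} := fun _ _ R => RelMorphism.IsAdmissible R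

instance : isCRG.{u, v}.IsMultiplicative where
  id_mem E := (RelMorphism.id_isAdmissible E).toIsCRG
  comp_mem _ _ hR hS := RelMorphism.IsCRG.comp hR hS

instance : isAdmissible.{u, v}.IsMultiplicative where
  id_mem E := RelMorphism.id_isAdmissible E
  comp_mem _ _ hR hS := RelMorphism.IsAdmissible.comp hR hS

/-- The subcategory `CRG` of `RG`; its objects are all directed graphs. -/
abbrev CRG : Type (max (u + 1) (v + 1)) := WideSubcategory isCRG.{u, v}

/-- The subcategory `ARG` of `RG` of admissible relation morphisms; its objects are all directed
graphs. -/
abbrev ARG : Type (max (u + 1) (v + 1)) := WideSubcategory isAdmissible.{u, v}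

/-! ### Algebras presented by generators and relations -/

section StarMonoidAlgebra

variable {X : Type w} [InvolutiveStar X]

/-- The involution of the free semigroup that reverses words and applies the given involution to
the letters. -/
instance : StarMul (FreeSemigroup X) where
  star a := (FreeSemigroup.lift (fun x : X => MulOpposite.op (FreeSemigroup.of (star x))) a).unop
  star_involutive a := by
    induction a using FreeSemigroup.recOnMul with
    | ih1 x => simp
    | ih2 x y hx hy => simp_all
  star_mul a b := by simp

lemma FreeSemigroup.star_of (x : X) :
    star (FreeSemigroup.of x) = FreeSemigroup.of (star x) := by
  simp [star]

variable {M : Type w} [Semigroup M] [StarMul M]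

/-- The conjugate-linear extension of the involution of a semigroup to its semigroup algebra. -/
def starAux : MonoidAlgebra ℂ M →+ MonoidAlgebra ℂ M :=
  (Finsupp.liftAddHom fun m => (MonoidAlgebra.singleAddHom (star m)).comp
    (starAddEquiv : ℂ ≃+ ℂ).toAddMonoidHom).comp MonoidAlgebra.coeffAddEquiv.toAddMonoidHom

lemma starAux_single (m : M) (c : ℂ) :
    starAux (MonoidAlgebra.single m c) = MonoidAlgebra.single (star m) (star c) := by
  simp [starAux]

instance : StarRing (MonoidAlgebra ℂ M) where
  star := starAux
  star_involutive a := by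
    have : (starAux (M := M)).comp starAux = AddMonoidHom.id _ := by
      ext m c : 2
      simp [starAux_single]
    exact DFunLike.congr_fun this a
  star_mul a b := by
    change starAux (a * b) = starAux b * starAux a
    induction a using MonoidAlgebra.induction_linear with
    | zero => simp
    | add a a' h h' => simp only [add_mul, mul_add, map_add, h, h']
    | single m c =>
      induction b using MonoidAlgebra.induction_linear with
      | zero => simp
      | add b b' h h' => simp only [add_mul, mul_add, map_add, h, h']
      | single n d => simp [starAux_single, MonoidAlgebra.single_mul_single, mul_comm]
  star_add a b := map_add _ a b

lemma star_single (m : M) (c : ℂ) :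
    star (MonoidAlgebra.single m c) = MonoidAlgebra.single (star m) (star c) :=
  starAux_single m c

instance : StarModule ℂ (MonoidAlgebra ℂ M) where
  star_smul c a := by
    induction a using MonoidAlgebra.induction_linear with
    | zero => simp
    | add a b ha hb => simp [ha, hb]
    | single m d => simp [star_single]

end StarMonoidAlgebra

/-- A two-sided ideal, stable under the involution, of a complex *-algebra. -/
structure StarIdeal (A : Type w) [NonUnitalRing A] [Module ℂ A] [Star A] where
  /-- the underlying linear subspace -/
  carrier : Submodule ℂ A
  mul_left : ∀ (a : A) {x : A}, x ∈ carrier → a * x ∈ carrier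
  mul_right : ∀ {x : A} (a : A), x ∈ carrier → x * a ∈ carrier
  star_mem : ∀ {x : A}, x ∈ carrier → star x ∈ carrier

namespace StarIdeal

variable {A : Type w} [NonUnitalRing A] [Module ℂ A] [IsScalarTower ℂ A A] [SMulCommClass ℂ A A]
  [StarRing A] [StarModule ℂ A]

/-- The two-sided ideal generated by a set `S` that is stable under the involution. -/
def span (S : Set A) (hS : ∀ x ∈ S, star x ∈ S) : StarIdeal A where
  carrier := sInf {J : Submodule ℂ A | S ⊆ J ∧ ∀ x ∈ J, ∀ a : A, a * x ∈ J ∧ x * a ∈ J}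
  mul_left a x hx := by
    simp only [Submodule.mem_sInf, Set.mem_ofPred_eq] at hx ⊢
    exact fun J hJ => (hJ.2 x (hx J hJ) a).1
  mul_right a hx := by
    simp only [Submodule.mem_sInf, Set.mem_ofPred_eq] at hx ⊢
    exact fun J hJ => (hJ.2 _ (hx J hJ) a).2
  star_mem {x} hx := by
    simp only [Submodule.mem_sInf, Set.mem_ofPred_eq] at hx ⊢
    intro J hJ
    let J' : Submodule ℂ A :=
      { carrier := {y | star y ∈ J}
        add_mem' := fun {a b} ha hb => by
          simp only [Set.mem_ofPred_eq, star_add] at *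
          exact J.add_mem ha hb
        zero_mem' := by simp
        smul_mem' := fun c y hy => by
          simp only [Set.mem_ofPred_eq, star_smul] at *
          exact J.smul_mem _ hy }
    refine hx J' ⟨fun y hy => hJ.1 (hS y hy), fun y hy a => ⟨?_, ?_⟩⟩
    · change star (a * y) ∈ J
      rw [star_mul]
      exact (hJ.2 _ hy _).2
    · change star (y * a) ∈ J
      rw [star_mul]
      exact (hJ.2 _ hy _).1

lemma subset_span (S : Set A) (hS : ∀ x ∈ S, star x ∈ S) : S ⊆ (span S hS).carrier := by
  intro x hx
  simp only [span, SetLike.mem_coe, Submodule.mem_sInf, Set.mem_ofPred_eq]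
  exact fun J hJ => hJ.1 hx

/-- The quotient *-algebra by a two-sided *-ideal. -/
def Quotient (I : StarIdeal A) : Type w := A ⧸ I.carrier

variable (I : StarIdeal A)

/-- The quotient map. -/
def proj (a : A) : I.Quotient := Submodule.Quotient.mk (p := I.carrier) a

lemma proj_surjective : Function.Surjective I.proj := Submodule.mkQ_surjective I.carrier

lemma proj_eq {a b : A} : I.proj a = I.proj b ↔ a - b ∈ I.carrier := Submodule.Quotient.eq _

instance : AddCommGroup I.Quotient := inferInstanceAs (AddCommGroup (A ⧸ I.carrier))

instance : Module ℂ I.Quotient := inferInstanceAs (Module ℂ (A ⧸ I.carrier))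

instance : Mul I.Quotient where
  mul := _root_.Quotient.map₂ (· * ·) fun a a' h b b' h' => by
    have h1 : a - a' ∈ I.carrier := I.carrier.quotientRel_def.1 h
    have h2 : b - b' ∈ I.carrier := I.carrier.quotientRel_def.1 h'
    refine I.carrier.quotientRel_def.2 ?_
    have : a * b - a' * b' = (a - a') * b + a' * (b - b') := by
      rw [sub_mul, mul_sub]; abel
    rw [this]
    exact I.carrier.add_mem (I.mul_right _ h1) (I.mul_left _ h2)

instance : Star I.Quotient where
  star := _root_.Quotient.map star fun a a' h => by
    have h1 : a - a' ∈ I.carrier := I.carrier.quotientRel_def.1 h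
    refine I.carrier.quotientRel_def.2 ?_
    rw [← star_sub]
    exact I.star_mem h1

lemma proj_add (a b : A) : I.proj (a + b) = I.proj a + I.proj b := rfl
lemma proj_mul (a b : A) : I.proj (a * b) = I.proj a * I.proj b := rfl
lemma proj_star (a : A) : I.proj (star a) = star (I.proj a) := rfl
lemma proj_smul (c : ℂ) (a : A) : I.proj (c • a) = c • I.proj a := rfl
lemma proj_zero : I.proj 0 = 0 := rfl

instance : NonUnitalRing I.Quotient where
  left_distrib a b c := by
    obtain ⟨a, rfl⟩ := I.proj_surjective a
    obtain ⟨b, rfl⟩ := I.proj_surjective b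
    obtain ⟨c, rfl⟩ := I.proj_surjective c
    simp only [← proj_add, ← proj_mul, mul_add]
  right_distrib a b c := by
    obtain ⟨a, rfl⟩ := I.proj_surjective a
    obtain ⟨b, rfl⟩ := I.proj_surjective b
    obtain ⟨c, rfl⟩ := I.proj_surjective c
    simp only [← proj_add, ← proj_mul, add_mul]
  zero_mul a := by
    obtain ⟨a, rfl⟩ := I.proj_surjective a
    rw [← proj_zero, ← proj_mul, zero_mul]
  mul_zero a := by
    obtain ⟨a, rfl⟩ := I.proj_surjective a
    rw [← proj_zero, ← proj_mul, mul_zero]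
  mul_assoc a b c := by
    obtain ⟨a, rfl⟩ := I.proj_surjective a
    obtain ⟨b, rfl⟩ := I.proj_surjective b
    obtain ⟨c, rfl⟩ := I.proj_surjective c
    simp only [← proj_mul, mul_assoc]

instance : IsScalarTower ℂ I.Quotient I.Quotient where
  smul_assoc c a b := by
    obtain ⟨a, rfl⟩ := I.proj_surjective a
    obtain ⟨b, rfl⟩ := I.proj_surjective b
    simp only [smul_eq_mul, ← proj_smul, ← proj_mul, smul_mul_assoc]

instance : SMulCommClass ℂ I.Quotient I.Quotient where
  smul_comm c a b := by
    obtain ⟨a, rfl⟩ := I.proj_surjective a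
    obtain ⟨b, rfl⟩ := I.proj_surjective b
    simp only [smul_eq_mul, ← proj_smul, ← proj_mul, mul_smul_comm]

instance : StarRing I.Quotient where
  star_involutive a := by
    obtain ⟨a, rfl⟩ := I.proj_surjective a
    simp only [← proj_star, star_star]
  star_mul a b := by
    obtain ⟨a, rfl⟩ := I.proj_surjective a
    obtain ⟨b, rfl⟩ := I.proj_surjective b
    simp only [← proj_star, ← proj_mul, star_mul]
  star_add a b := by
    obtain ⟨a, rfl⟩ := I.proj_surjective a
    obtain ⟨b, rfl⟩ := I.proj_surjective b
    simp only [← proj_star, ← proj_add, star_add]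

instance : StarModule ℂ I.Quotient where
  star_smul c a := by
    obtain ⟨a, rfl⟩ := I.proj_surjective a
    simp only [← proj_star, ← proj_smul, star_smul]

end StarIdeal

/-! ### Cohn and Leavitt path algebras over `ℂ` -/

/-- The generators of the Cohn and Leavitt path algebras: `S_a` for a vertex `a`, and `S_e` and
`S_{e*}` for an edge `e`. -/
inductive Gen (E : DGraph.{u, v}) : Type (max u v)
  | vertex (a : E.V)
  | edge (e : E.Edge)
  | ghost (e : E.Edge)

/-- The involution of the generators: `S_a* = S_a`, `(S_e)* = S_{e*}`, `(S_{e*})* = S_e`. -/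
instance (E : DGraph.{u, v}) : InvolutiveStar (Gen E) where
  star
    | .vertex a => .vertex a
    | .edge e => .ghost e
    | .ghost e => .edge e
  star_involutive g := by cases g <;> rfl

@[simp] lemma Gen.star_vertex {E : DGraph.{u, v}} (a : E.V) :
    star (Gen.vertex a : Gen E) = Gen.vertex a := rfl
@[simp] lemma Gen.star_edge {E : DGraph.{u, v}} (e : E.Edge) :
    star (Gen.edge e : Gen E) = Gen.ghost e := rfl
@[simp] lemma Gen.star_ghost {E : DGraph.{u, v}} (e : E.Edge) :
    star (Gen.ghost e : Gen E) = Gen.edge e := rfl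

/-- The free associative (non-unital) complex algebra on the generators; its involution is
induced by the one of the generators. -/
abbrev FreeAlg (E : DGraph.{u, v}) : Type (max u v) := MonoidAlgebra ℂ (FreeSemigroup (Gen E))

/-- A generator as an element of the free algebra. -/
def gen {E : DGraph.{u, v}} (g : Gen E) : FreeAlg E := MonoidAlgebra.single (FreeSemigroup.of g) 1

lemma star_gen {E : DGraph.{u, v}} (g : Gen E) : star (gen g) = gen (star g) := by
  simp [gen, star_single, FreeSemigroup.star_of]

open Gen in
/-- The defining relations of the Cohn path algebra (each element is set to zero). -/
inductive CohnRel (E : DGraph.{u, v}) : FreeAlg E → Prop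
  | V_same (a : E.V) : CohnRel E (gen (vertex a) * gen (vertex a) - gen (vertex a))
  | V_ne (a b : E.V) (h : a ≠ b) : CohnRel E (gen (vertex a) * gen (vertex b))
  | E1_source (e : E.Edge) : CohnRel E (gen (vertex (E.s e)) * gen (edge e) - gen (edge e))
  | E1_target (e : E.Edge) : CohnRel E (gen (edge e) * gen (vertex (E.t e)) - gen (edge e))
  | E2_target (e : E.Edge) : CohnRel E (gen (vertex (E.t e)) * gen (ghost e) - gen (ghost e))
  | E2_source (e : E.Edge) : CohnRel E (gen (ghost e) * gen (vertex (E.s e)) - gen (ghost e))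
  | CK1_same (e : E.Edge) : CohnRel E (gen (ghost e) * gen (edge e) - gen (vertex (E.t e)))
  | CK1_ne (e e' : E.Edge) (h : e ≠ e') : CohnRel E (gen (ghost e) * gen (edge e'))

open Gen in
/-- The defining relations of the Leavitt path algebra: the Cohn relations and (CK2),
`S_a = ∑_{s(e) = a} S_e S_{e*}` for every regular vertex `a`. -/
inductive LeavittRel (E : DGraph.{u, v}) : FreeAlg E → Prop
  | cohn (x : FreeAlg E) (h : CohnRel E x) : LeavittRel E x
  | CK2 (a : E.V) (ha : E.IsRegular a) :
      LeavittRel E (gen (vertex a) - ∑ e ∈ ha.2.toFinset, gen (edge e) * gen (ghost e))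

lemma CohnRel.star {E : DGraph.{u, v}} {x : FreeAlg E} (h : CohnRel E x) :
    CohnRel E (star x) := by
  cases h with
  | V_same a => simpa [star_gen] using CohnRel.V_same a
  | V_ne a b h => simpa [star_gen] using CohnRel.V_ne b a h.symm
  | E1_source e => simpa [star_gen] using CohnRel.E2_source e
  | E1_target e => simpa [star_gen] using CohnRel.E2_target e
  | E2_target e => simpa [star_gen] using CohnRel.E1_target e
  | E2_source e => simpa [star_gen] using CohnRel.E1_source e
  | CK1_same e => simpa [star_gen] using CohnRel.CK1_same e
  | CK1_ne e e' h => simpa [star_gen] using CohnRel.CK1_ne e' e h.symm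

lemma LeavittRel.star {E : DGraph.{u, v}} {x : FreeAlg E} (h : LeavittRel E x) :
    LeavittRel E (star x) := by
  cases h with
  | cohn x h => exact .cohn _ h.star
  | CK2 a ha => simpa [star_gen, star_sum] using LeavittRel.CK2 a ha

/-- The ideal generated by the Cohn relations. -/
def cohnIdeal (E : DGraph.{u, v}) : StarIdeal (FreeAlg E) :=
  StarIdeal.span {x | CohnRel E x} fun _ h => h.star

/-- The ideal generated by the Leavitt relations. -/
def leavittIdeal (E : DGraph.{u, v}) : StarIdeal (FreeAlg E) :=
  StarIdeal.span {x | LeavittRel E x} fun _ h => h.star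

/-- The Cohn path *-algebra of a graph over `ℂ`. -/
abbrev CohnPathAlgebra (E : DGraph.{u, v}) : Type (max u v) := (cohnIdeal E).Quotient

/-- The Leavitt path *-algebra of a graph over `ℂ`. -/
abbrev LeavittPathAlgebra (E : DGraph.{u, v}) : Type (max u v) := (leavittIdeal E).Quotient

/-- The element `S_x` for a finite path `x`: `S_a` if `x` is the vertex `a`, and the product
`S_{e₁} ⋯ S_{eₙ}` if `x = e₁ ⋯ eₙ` with `n ≥ 1`. -/
def pathElement {E : DGraph.{u, v}} {I : StarIdeal (FreeAlg E)} (x : FinPath E) : I.Quotient :=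
  match x.edges with
  | [] => I.proj (gen (.vertex x.src))
  | e :: l => l.foldl (fun a e' => a * I.proj (gen (.edge e'))) (I.proj (gen (.edge e)))

/-! ### The universal enveloping C*-algebra -/

section Envelope

variable (A : Type w) [NonUnitalRing A] [Module ℂ A] [IsScalarTower ℂ A A] [SMulCommClass ℂ A A]
  [StarRing A] [StarModule ℂ A]

/-- A C*-seminorm on a complex *-algebra. -/
structure CStarSeminorm extends Seminorm ℂ A where
  mul_le' : ∀ a b : A, toFun (a * b) ≤ toFun a * toFun b
  cstar' : ∀ a : A, toFun (star a * a) = toFun a * toFun a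

/-- The universal enveloping C*-algebra of `A` exists if the C*-seminorms on `A` are pointwise
bounded. -/
class HasEnvelope : Prop where
  bdd : ∀ a : A, BddAbove (Set.range fun q : CStarSeminorm A => q.toSeminorm a)

variable {A}

instance : Inhabited (CStarSeminorm A) where
  default :=
    { toSeminorm := 0
      mul_le' := fun a b => by change (0 : ℝ) ≤ 0 * 0; simp
      cstar' := fun a => by change (0 : ℝ) = 0 * 0; simp }

lemma CStarSeminorm.mul_le (q : CStarSeminorm A) (a b : A) :
    q.toSeminorm (a * b) ≤ q.toSeminorm a * q.toSeminorm b := q.mul_le' a b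

lemma CStarSeminorm.cstar (q : CStarSeminorm A) (a : A) :
    q.toSeminorm (star a * a) = q.toSeminorm a * q.toSeminorm a := q.cstar' a

lemma CStarSeminorm.star_le (q : CStarSeminorm A) (a : A) : q.toSeminorm (star a) ≤ q.toSeminorm a := by
  by_cases h : q.toSeminorm (star a) = 0
  · rw [h]; exact apply_nonneg _ _
  · have hpos := lt_of_le_of_ne (apply_nonneg q.toSeminorm (star a)) (Ne.symm h)
    have h1 := q.cstar (star a)
    have h2 := q.mul_le (star (star a)) (star a)
    rw [h1, star_star] at h2
    exact le_of_mul_le_mul_right h2 hpos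

/-- The greatest C*-seminorm: the supremum of all C*-seminorms. -/
def universalSeminorm (a : A) : ℝ := ⨆ q : CStarSeminorm A, q.toSeminorm a

section

variable [HasEnvelope A]

lemma le_universalSeminorm (q : CStarSeminorm A) (a : A) :
    q.toSeminorm a ≤ universalSeminorm a := le_ciSup (HasEnvelope.bdd a) q

lemma universalSeminorm_nonneg (a : A) : 0 ≤ universalSeminorm a :=
  (apply_nonneg (default : CStarSeminorm A).toSeminorm a).trans (le_universalSeminorm _ a)

lemma universalSeminorm_add (a b : A) :
    universalSeminorm (a + b) ≤ universalSeminorm a + universalSeminorm b :=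
  ciSup_le fun q => (map_add_le_add q.toSeminorm a b).trans
    (add_le_add (le_universalSeminorm q a) (le_universalSeminorm q b))

lemma universalSeminorm_mul (a b : A) :
    universalSeminorm (a * b) ≤ universalSeminorm a * universalSeminorm b :=
  ciSup_le fun q => (q.mul_le a b).trans
    (mul_le_mul (le_universalSeminorm q a) (le_universalSeminorm q b)
      (apply_nonneg _ _) (universalSeminorm_nonneg a))

lemma universalSeminorm_smul_le (c : ℂ) (a : A) :
    universalSeminorm (c • a) ≤ ‖c‖ * universalSeminorm a :=
  ciSup_le fun q => by
    rw [map_smul_eq_mul]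
    exact mul_le_mul_of_nonneg_left (le_universalSeminorm q a) (norm_nonneg c)

lemma universalSeminorm_cstar (a : A) :
    universalSeminorm (star a * a) = universalSeminorm a * universalSeminorm a := by
  apply le_antisymm
  · refine ciSup_le fun q => ?_
    rw [q.cstar]
    exact mul_le_mul (le_universalSeminorm q a) (le_universalSeminorm q a)
      (apply_nonneg _ _) (universalSeminorm_nonneg a)
  · have h : universalSeminorm a ≤ Real.sqrt (universalSeminorm (star a * a)) := by
      refine ciSup_le fun q => Real.le_sqrt_of_sq_le ?_
      rw [sq, ← q.cstar]
      exact le_universalSeminorm q _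
    calc universalSeminorm a * universalSeminorm a
        ≤ Real.sqrt (universalSeminorm (star a * a)) *
            Real.sqrt (universalSeminorm (star a * a)) :=
          mul_le_mul h h (universalSeminorm_nonneg a) (Real.sqrt_nonneg _)
      _ = _ := Real.mul_self_sqrt (universalSeminorm_nonneg _)

lemma universalSeminorm_star_le (a : A) : universalSeminorm (star a) ≤ universalSeminorm a := by
  by_cases h : universalSeminorm (star a) = 0
  · rw [h]; exact universalSeminorm_nonneg a
  · have hpos := lt_of_le_of_ne (universalSeminorm_nonneg (star a)) (Ne.symm h)
    have h1 := universalSeminorm_cstar (star a)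
    have h2 := universalSeminorm_mul (star (star a)) (star a)
    rw [h1, star_star] at h2
    exact le_of_mul_le_mul_right h2 hpos

end

variable (A) in
/-- A copy of `A`, equipped with the greatest C*-seminorm. -/
def PreEnvelope : Type w := A

section

variable [HasEnvelope A]

instance : NonUnitalRing (PreEnvelope A) := inferInstanceAs (NonUnitalRing A)
instance : Module ℂ (PreEnvelope A) := inferInstanceAs (Module ℂ A)
instance : IsScalarTower ℂ (PreEnvelope A) (PreEnvelope A) :=
  inferInstanceAs (IsScalarTower ℂ A A)
instance : SMulCommClass ℂ (PreEnvelope A) (PreEnvelope A) :=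
  inferInstanceAs (SMulCommClass ℂ A A)
instance : StarRing (PreEnvelope A) := inferInstanceAs (StarRing A)
instance : StarModule ℂ (PreEnvelope A) := inferInstanceAs (StarModule ℂ A)

/-- The greatest C*-seminorm as a seminorm. -/
def preNorm : AddGroupSeminorm (PreEnvelope A) where
  toFun := universalSeminorm (A := A)
  map_zero' := le_antisymm
    (ciSup_le fun q : CStarSeminorm A => (map_zero q.toSeminorm).le) (universalSeminorm_nonneg _)
  add_le' := universalSeminorm_add (A := A)
  neg' a := by
    unfold universalSeminorm
    congr 1
    funext q
    exact map_neg_eq_map q.toSeminorm a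

instance : NonUnitalSeminormedRing (PreEnvelope A) :=
  { (preNorm (A := A)).toSeminormedAddCommGroup, (inferInstance : NonUnitalRing (PreEnvelope A)) with
    norm_mul_le := universalSeminorm_mul (A := A) }

instance : NormedSpace ℂ (PreEnvelope A) where
  norm_smul_le := universalSeminorm_smul_le (A := A)

lemma PreEnvelope.norm_def (a : PreEnvelope A) : ‖a‖ = universalSeminorm (A := A) a := rfl

lemma PreEnvelope.norm_star_mul_self (a : PreEnvelope A) : ‖star a * a‖ = ‖a‖ * ‖a‖ :=
  universalSeminorm_cstar (A := A) a

instance : NormedStarGroup (PreEnvelope A) where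
  norm_star_le := universalSeminorm_star_le (A := A)

variable (A) in
/-- The universal enveloping C*-algebra of a complex *-algebra: the Hausdorff completion with
respect to the greatest C*-seminorm. -/
def CStarEnvelope : Type w := UniformSpace.Completion (PreEnvelope A)

namespace CStarEnvelope

open UniformSpace

instance : NormedAddCommGroup (CStarEnvelope A) :=
  inferInstanceAs (NormedAddCommGroup (Completion (PreEnvelope A)))

instance : NormedSpace ℂ (CStarEnvelope A) :=
  inferInstanceAs (NormedSpace ℂ (Completion (PreEnvelope A)))

instance : CompleteSpace (CStarEnvelope A) :=
  inferInstanceAs (CompleteSpace (Completion (PreEnvelope A)))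

/-- The canonical map into the completion. -/
def coe (a : PreEnvelope A) : CStarEnvelope A := ((a : PreEnvelope A) : Completion (PreEnvelope A))

lemma isDenseInducing_coe : IsDenseInducing (coe (A := A)) :=
  Completion.isDenseInducing_coe (α := PreEnvelope A)

lemma continuous_coe : Continuous (coe (A := A)) := isDenseInducing_coe.continuous

lemma norm_coe (a : PreEnvelope A) : ‖coe a‖ = ‖a‖ := Completion.norm_coe a

lemma coe_add (a b : PreEnvelope A) : coe (a + b) = coe a + coe b := Completion.coe_add a b
lemma coe_zero : coe (0 : PreEnvelope A) = 0 := rfl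
lemma coe_smul (c : ℂ) (a : PreEnvelope A) : coe (c • a) = c • coe a := Completion.coe_smul c a

instance : Mul (CStarEnvelope A) where
  mul a b := (isDenseInducing_coe.prodMap isDenseInducing_coe).extend
    (fun p : PreEnvelope A × PreEnvelope A => coe (p.1 * p.2)) (a, b)

lemma coe_mul (a b : PreEnvelope A) : coe (a * b) = coe a * coe b :=
  ((isDenseInducing_coe.prodMap isDenseInducing_coe).extend_eq
    (continuous_coe.comp (continuous_mul (M := PreEnvelope A))) (a, b)).symm

instance : ContinuousMul (CStarEnvelope A) where
  continuous_mul := by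
    let c : PreEnvelope A →+ CStarEnvelope A :=
      { toFun := coe, map_zero' := coe_zero, map_add' := coe_add }
    let m := (AddMonoidHom.mul : PreEnvelope A →+ PreEnvelope A →+ PreEnvelope A).compr₂ c
    have : Continuous fun p : PreEnvelope A × PreEnvelope A => m p.1 p.2 :=
      continuous_coe.comp continuous_mul
    have di : IsDenseInducing (c : PreEnvelope A → CStarEnvelope A) := isDenseInducing_coe
    exact (di.extend_Z_bilin di this :)

instance : Star (CStarEnvelope A) where
  star := Completion.map (star : PreEnvelope A → PreEnvelope A)

lemma coe_star (a : PreEnvelope A) : coe (star a) = star (coe a) :=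
  (Completion.map_coe (starNormedAddGroupHom (E := PreEnvelope A)).uniformContinuous a).symm

instance : ContinuousStar (CStarEnvelope A) where
  continuous_star := Completion.continuous_map

lemma induction {p : CStarEnvelope A → Prop} (hp : IsClosed {a | p a}) (h : ∀ a, p (coe a))
    (a : CStarEnvelope A) : p a := Completion.induction_on (α := PreEnvelope A) a hp h

lemma induction₂ {p : CStarEnvelope A → CStarEnvelope A → Prop}
    (hp : IsClosed {a : CStarEnvelope A × CStarEnvelope A | p a.1 a.2})
    (h : ∀ a b, p (coe a) (coe b)) (a b : CStarEnvelope A) : p a b :=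
  Completion.induction_on₂ (α := PreEnvelope A) (β := PreEnvelope A) a b hp h

lemma induction₃ {p : CStarEnvelope A → CStarEnvelope A → CStarEnvelope A → Prop}
    (hp : IsClosed {a : CStarEnvelope A × CStarEnvelope A × CStarEnvelope A | p a.1 a.2.1 a.2.2})
    (h : ∀ a b c, p (coe a) (coe b) (coe c)) (a b c : CStarEnvelope A) : p a b c :=
  Completion.induction_on₃ (α := PreEnvelope A) (β := PreEnvelope A) (γ := PreEnvelope A)
    a b c hp h

instance : NonUnitalRing (CStarEnvelope A) where
  left_distrib := induction₃ (isClosed_eq (by fun_prop) (by fun_prop)) fun a b c => by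
    simp only [← coe_add, ← coe_mul, mul_add]
  right_distrib := induction₃ (isClosed_eq (by fun_prop) (by fun_prop)) fun a b c => by
    simp only [← coe_add, ← coe_mul, add_mul]
  mul_assoc := induction₃ (isClosed_eq (by fun_prop) (by fun_prop)) fun a b c => by
    simp only [← coe_mul, mul_assoc]
  zero_mul := induction (isClosed_eq (by fun_prop) (by fun_prop)) fun a => by
    rw [← coe_zero, ← coe_mul, zero_mul]
  mul_zero := induction (isClosed_eq (by fun_prop) (by fun_prop)) fun a => by
    rw [← coe_zero, ← coe_mul, mul_zero]

instance : NonUnitalNormedRing (CStarEnvelope A) :=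
  { (inferInstance : NormedAddCommGroup (CStarEnvelope A)),
    (inferInstance : NonUnitalRing (CStarEnvelope A)) with
    norm_mul_le := induction₂ (isClosed_le (by fun_prop) (by fun_prop)) fun a b => by
      rw [← coe_mul, norm_coe, norm_coe, norm_coe]
      exact norm_mul_le a b }

instance : StarRing (CStarEnvelope A) where
  star_involutive := induction (isClosed_eq (by fun_prop) (by fun_prop)) fun a => by
    simp only [← coe_star, star_star]
  star_mul := induction₂ (isClosed_eq (by fun_prop) (by fun_prop)) fun a b => by
    simp only [← coe_star, ← coe_mul, star_mul]
  star_add := induction₂ (isClosed_eq (by fun_prop) (by fun_prop)) fun a b => by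
    simp only [← coe_star, ← coe_add, star_add]

lemma smul_mul (c : ℂ) : ∀ a b : CStarEnvelope A, (c • a) * b = c • (a * b) :=
  induction₂ (isClosed_eq ((continuous_fst.const_smul c).mul continuous_snd)
    ((continuous_fst.mul continuous_snd).const_smul c)) fun a b => by
    rw [← coe_smul, ← coe_mul, ← coe_mul, ← coe_smul, smul_mul_assoc]

lemma mul_smul' (c : ℂ) : ∀ a b : CStarEnvelope A, c • (a * b) = a * (c • b) :=
  induction₂ (isClosed_eq ((continuous_fst.mul continuous_snd).const_smul c)
    (continuous_fst.mul (continuous_snd.const_smul c))) fun a b => by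
    rw [← coe_smul, ← coe_mul, ← coe_mul, ← coe_smul, mul_smul_comm]

lemma star_smul' (c : ℂ) : ∀ a : CStarEnvelope A, star (c • a) = star c • star a :=
  induction (isClosed_eq (continuous_id.const_smul c).star
    (continuous_id.star.const_smul (star c))) fun a => by
    rw [← coe_smul, ← coe_star, ← coe_star, ← coe_smul, star_smul]

lemma norm_mul_self_le' : ∀ a : CStarEnvelope A, ‖a‖ * ‖a‖ ≤ ‖star a * a‖ :=
  induction (isClosed_le (by fun_prop) (by fun_prop)) fun a => by
    rw [← coe_star, ← coe_mul, norm_coe, norm_coe, PreEnvelope.norm_star_mul_self]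

instance : NonUnitalCStarAlgebra (CStarEnvelope A) where
  norm_mul_self_le := norm_mul_self_le'
  smul_assoc := smul_mul
  smul_comm := mul_smul'
  star_smul := star_smul'

end CStarEnvelope

variable (A) in
/-- The canonical *-homomorphism of `A` into its universal enveloping C*-algebra. -/
def toEnvelope : A →⋆ₙₐ[ℂ] CStarEnvelope A where
  toFun a := CStarEnvelope.coe a
  map_smul' c a := CStarEnvelope.coe_smul c a
  map_zero' := CStarEnvelope.coe_zero
  map_add' a b := CStarEnvelope.coe_add a b
  map_mul' a b := CStarEnvelope.coe_mul a b
  map_star' a := CStarEnvelope.coe_star a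

end

end Envelope

/-! ### Toeplitz graph C*-algebras and graph C*-algebras -/

/-- A *-algebra that satisfies the Cohn relations has a universal enveloping C*-algebra, because
its generators are partial isometries. -/
lemma hasEnvelope_of_cohnRel {E : DGraph.{u, v}} (I : StarIdeal (FreeAlg E))
    (hI : ∀ x, CohnRel E x → x ∈ I.carrier) : HasEnvelope I.Quotient := by
  have hvert : ∀ (q : CStarSeminorm I.Quotient) (a : E.V),
      q.toSeminorm (I.proj (gen (.vertex a))) ≤ 1 := by
    intro q a
    have h1 : star (I.proj (gen (.vertex a))) * I.proj (gen (.vertex a)) =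
        I.proj (gen (.vertex a)) := by
      rw [← I.proj_star, star_gen, Gen.star_vertex, ← I.proj_mul, I.proj_eq]
      exact hI _ (.V_same a)
    have h2 := q.cstar (I.proj (gen (.vertex a)))
    rw [h1] at h2
    nlinarith [apply_nonneg q.toSeminorm (I.proj (gen (.vertex a)))]
  have hedge : ∀ (q : CStarSeminorm I.Quotient) (e : E.Edge),
      q.toSeminorm (I.proj (gen (.edge e))) ≤ 1 := by
    intro q e
    have h1 : star (I.proj (gen (.edge e))) * I.proj (gen (.edge e)) =
        I.proj (gen (.vertex (E.t e))) := by
      rw [← I.proj_star, star_gen, Gen.star_edge, ← I.proj_mul, I.proj_eq]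
      exact hI _ (.CK1_same e)
    have h2 := q.cstar (I.proj (gen (.edge e)))
    rw [h1] at h2
    nlinarith [apply_nonneg q.toSeminorm (I.proj (gen (.edge e))), hvert q (E.t e)]
  have hgen : ∀ (q : CStarSeminorm I.Quotient) (g : Gen E),
      q.toSeminorm (I.proj (gen g)) ≤ 1 := by
    intro q g
    cases g with
    | vertex a => exact hvert q a
    | edge e => exact hedge q e
    | ghost e =>
      rw [← Gen.star_edge, ← star_gen, I.proj_star]
      exact (q.star_le _).trans (hedge q e)
  have hword : ∀ (q : CStarSeminorm I.Quotient) (m : FreeSemigroup (Gen E)),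
      q.toSeminorm (I.proj (MonoidAlgebra.single m 1)) ≤ 1 := by
    intro q m
    induction m using FreeSemigroup.recOnMul with
    | ih1 g => exact hgen q g
    | ih2 g m hg hm =>
      have h1 : (MonoidAlgebra.single (FreeSemigroup.of g * m) 1 : FreeAlg E) =
          MonoidAlgebra.single (FreeSemigroup.of g) 1 * MonoidAlgebra.single m 1 := by
        simp [MonoidAlgebra.single_mul_single]
      rw [h1, I.proj_mul]
      exact (q.mul_le _ _).trans (mul_le_one₀ hg (apply_nonneg _ _) hm)
  refine ⟨fun a => ?_⟩
  obtain ⟨f, rfl⟩ := I.proj_surjective a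
  induction f using MonoidAlgebra.induction_linear with
  | zero =>
    refine ⟨0, ?_⟩
    rintro _ ⟨q, rfl⟩
    rw [I.proj_zero]
    exact (map_zero q.toSeminorm).le
  | add f g hf hg =>
    obtain ⟨C, hC⟩ := hf
    obtain ⟨D, hD⟩ := hg
    refine ⟨C + D, ?_⟩
    rintro _ ⟨q, rfl⟩
    exact (map_add_le_add q.toSeminorm _ _).trans (add_le_add (hC ⟨q, rfl⟩) (hD ⟨q, rfl⟩))
  | single m c =>
    refine ⟨‖c‖, ?_⟩
    rintro _ ⟨q, rfl⟩
    have h1 : (MonoidAlgebra.single m c : FreeAlg E) = c • MonoidAlgebra.single m 1 := by simp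
    change q.toSeminorm _ ≤ _
    rw [h1, I.proj_smul, map_smul_eq_mul]
    exact mul_le_of_le_one_right (norm_nonneg c) (hword q m)

lemma mem_cohnIdeal {E : DGraph.{u, v}} {x : FreeAlg E} (h : CohnRel E x) :
    x ∈ (cohnIdeal E).carrier :=
  StarIdeal.subset_span {x | CohnRel E x} (fun _ h => h.star) h

lemma mem_leavittIdeal {E : DGraph.{u, v}} {x : FreeAlg E} (h : LeavittRel E x) :
    x ∈ (leavittIdeal E).carrier :=
  StarIdeal.subset_span {x | LeavittRel E x} (fun _ h => h.star) h

instance (E : DGraph.{u, v}) : HasEnvelope (CohnPathAlgebra E) :=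
  hasEnvelope_of_cohnRel (cohnIdeal E) fun _ h => mem_cohnIdeal h

instance (E : DGraph.{u, v}) : HasEnvelope (LeavittPathAlgebra E) :=
  hasEnvelope_of_cohnRel (leavittIdeal E) fun x h => mem_leavittIdeal (.cohn x h)

/-- The Toeplitz graph C*-algebra: the universal enveloping C*-algebra of the Cohn path
*-algebra. -/
abbrev ToeplitzCStar (E : DGraph.{u, v}) : Type (max u v) := CStarEnvelope (CohnPathAlgebra E)

/-- The graph C*-algebra: the universal enveloping C*-algebra of the Leavitt path *-algebra. -/
abbrev GraphCStar (E : DGraph.{u, v}) : Type (max u v) := CStarEnvelope (LeavittPathAlgebra E)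

/-! ### The category of C*-algebras and induced homomorphisms -/

/-- A (not necessarily unital) C*-algebra. -/
structure CStarAlg : Type (w + 1) where
  /-- the underlying type -/
  carrier : Type w
  [str : NonUnitalCStarAlgebra carrier]

attribute [instance] CStarAlg.str

/-- The category of C*-algebras and *-homomorphisms. -/
instance : Category CStarAlg.{w} where
  Hom A B := A.carrier →⋆ₙₐ[ℂ] B.carrier
  id A := NonUnitalStarAlgHom.id ℂ A.carrier
  comp f g := g.comp f

/-- The formula `S_y ↦ ∑_{x ∈ R⁻¹(y)} S_x` for vertices and edges `y` and
`S_{f*} ↦ ∑_{x ∈ R⁻¹(f)} S_{x*}` for edges `f`, where `S_{x*} = (S_x)*`, for a *-homomorphism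
between quotients of the free algebras. (The sums are finite when `R` is proper.) -/
structure IsInduced {E F : DGraph.{u, v}} (R : RelMorphism E F) {J : StarIdeal (FreeAlg F)}
    {I : StarIdeal (FreeAlg E)} (ρ : J.Quotient →⋆ₙₐ[ℂ] I.Quotient) : Prop where
  vertex : ∀ b : F.V, ρ (J.proj (gen (.vertex b))) =
    ∑ᶠ (x : FinPath E) (_ : x ∈ R.preimage (ofVertex b)), (pathElement x : I.Quotient)
  edge : ∀ f : F.Edge, ρ (J.proj (gen (.edge f))) =
    ∑ᶠ (x : FinPath E) (_ : x ∈ R.preimage (ofEdge f)), (pathElement x : I.Quotient)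
  ghost : ∀ f : F.Edge, ρ (J.proj (gen (.ghost f))) =
    ∑ᶠ (x : FinPath E) (_ : x ∈ R.preimage (ofEdge f)), star (pathElement x : I.Quotient)

end GraphRel

end

open GraphRel

noncomputable section

namespace GraphRel

open FinPath

variable {E F G : DGraph.{u, v}}

/-! Write `T_y` for the sum of the `S_x` over `x ∈ R⁻¹(y)` (`pathSum`); condition (3) makes it
finite. The theorem holds because `y ↦ T_y` carries the defining relations of the algebra of `F` to
relations that hold in the algebra of `E`.

In every quotient in which the Cohn relations hold, `S_x* S_x'` vanishes unless `x` and `x'` are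
comparable, `S_x* S_x = S_{t(x)}`, and `S_x S_x'*` vanishes unless the targets agree. Hence `T_{yz}
= T_y T_z` for composable paths by (1), (2) and (6) (`pathSum_concat`), and `T_y T_z = 0` for the
others by (4). In `T_f* T_f'` condition (6) leaves at most diagonal terms, and for `f = f'` the
bijection in (5) turns their sum into `T_{t(f)}`. This settles the Cohn case.

For (CK2), injectivity in (5) reduces `T_f T_f*` to the sum of the range projections `S_x S_x*` over
`R⁻¹(f)`. Fix a regular vertex `b` and `a ∈ R⁻¹(b)`. The paths that start at `a` and are related to
edges starting at `b` form a finite antichain by (3) and (6), and (7) says that every path from `a`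
is comparable to a member. The initial subpaths of the members form a finite tree, and each
branching vertex of this tree is regular in `E`. Expanding `S_a` by (CK2) along the tree shows that
`S_a` is the sum of the range projections of the antichain (`pathElement_mul_star_eq_sum`).
Summation over `a` gives (CK2) for the `T`'s (`pathSum_ofVertex_eq_sum`).

Functoriality is compared on generators. An element of `S⁻¹(g)` may be a long path, so the formula
`S_y ↦ T_y` is needed for all paths (`IsInduced.map_pathElement`); moreover, the sets `R⁻¹(y)` for
`y ∈ S⁻¹(g)` must be disjoint (`sum_pathSum`). The passage to C*-algebras is formal: C*-seminorms
pull back along *-homomorphisms, so these are contractive for the greatest C*-seminorms and extend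
to the completions, uniquely by density. -/

/-- Induction on finite paths by adding edges at the beginning. -/
theorem FinPath.inductionOn {P : FinPath E → Prop} (x : FinPath E)
    (vertex : ∀ a, P (ofVertex a))
    (cons : ∀ (e : E.Edge) (z : FinPath E) (h : (ofEdge e).tgt = z.src), P z →
      P ((ofEdge e).concat z h)) : P x := by
  induction hn : x.edges generalizing x with
  | nil => rw [eq_ofVertex hn]; exact vertex _
  | cons e l ih =>
    obtain ⟨z, hz, rfl, hl⟩ := exists_eq_cons hn
    exact cons e z hz (ih z hl)

/-! ### Products of path elements under the Cohn relations. -/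

section PathElement

lemma pathElement_ofVertex {I : StarIdeal (FreeAlg E)} (a : E.V) :
    (pathElement (ofVertex a) : I.Quotient) = I.proj (gen (.vertex a)) := rfl

lemma pathElement_ofEdge {I : StarIdeal (FreeAlg E)} (e : E.Edge) :
    (pathElement (ofEdge e) : I.Quotient) = I.proj (gen (.edge e)) := rfl

lemma proj_gen_ghost {I : StarIdeal (FreeAlg E)} (e : E.Edge) :
    I.proj (gen (.ghost e)) = star (pathElement (ofEdge e) : I.Quotient) := by
  rw [pathElement_ofEdge, ← I.proj_star, star_gen, Gen.star_edge]

lemma star_pathElement_ofVertex {I : StarIdeal (FreeAlg E)} (a : E.V) :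
    star (pathElement (ofVertex a) : I.Quotient) = pathElement (ofVertex a) := by
  rw [pathElement_ofVertex, ← I.proj_star, star_gen, Gen.star_vertex]

/-- `star_mul` for the involution and the multiplication of the quotient as such. -/
lemma StarIdeal.quotient_star_mul {I : StarIdeal (FreeAlg E)} (a b : I.Quotient) :
    star (a * b) = star b * star a := star_mul a b

lemma StarIdeal.quotient_star_zero {I : StarIdeal (FreeAlg E)} : star (0 : I.Quotient) = 0 :=
  star_zero _

lemma foldl_mul_left {R X : Type*} [Semigroup R] (f : X → R) (l : List X) (a b : R) :
    l.foldl (fun c x => c * f x) (a * b) = a * l.foldl (fun c x => c * f x) b := by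
  induction l generalizing b with
  | nil => rfl
  | cons x l ih => simp only [List.foldl_cons, mul_assoc, ih]

lemma StarIdeal.proj_eq_zero {A : Type w} [NonUnitalRing A] [Module ℂ A] [IsScalarTower ℂ A A]
    [SMulCommClass ℂ A A] [StarRing A] [StarModule ℂ A] (I : StarIdeal A) {a : A} :
    I.proj a = 0 ↔ a ∈ I.carrier := by
  rw [← I.proj_zero, I.proj_eq, sub_zero]

variable {I : StarIdeal (FreeAlg E)}

lemma pathElement_vertex_mul_self (hI : ∀ x, CohnRel E x → x ∈ I.carrier)
    (a : E.V) :
    (pathElement (ofVertex a) * pathElement (ofVertex a) : I.Quotient) =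
      pathElement (ofVertex a) := I.proj_eq.2 (hI _ (.V_same a))

lemma pathElement_vertex_mul_of_ne (hI : ∀ x, CohnRel E x → x ∈ I.carrier)
    {a b : E.V} (h : a ≠ b) :
    (pathElement (ofVertex a) * pathElement (ofVertex b) : I.Quotient) = 0 :=
  I.proj_eq_zero.2 (hI _ (.V_ne a b h))

/-- For a tail with edges this is associativity of the left-nested product. If the tail is a vertex,
its element is not part of that product and has to be absorbed by the relation `S_e S_{t(e)} = S_e`.
-/
lemma pathElement_cons (hI : ∀ x, CohnRel E x → x ∈ I.carrier)
    (e : E.Edge) (z : FinPath E) (h : (ofEdge e).tgt = z.src) :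
    (pathElement ((ofEdge e).concat z h) : I.Quotient) =
      pathElement (ofEdge e) * pathElement z := by
  obtain ⟨a, l, hw⟩ := z
  cases l with
  | nil =>
    obtain rfl : E.t e = a := h
    exact (I.proj_eq.2 (hI _ (.E1_target e))).symm
  | cons e' l => exact foldl_mul_left (fun e => I.proj (gen (.edge e))) l _ _

lemma pathElement_src_mul (hI : ∀ x, CohnRel E x → x ∈ I.carrier)
    (x : FinPath E) :
    (pathElement (ofVertex x.src) * pathElement x : I.Quotient) = pathElement x := by
  induction x using FinPath.inductionOn with
  | vertex a => exact pathElement_vertex_mul_self hI a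
  | cons e z h _ =>
    rw [pathElement_cons hI, ← mul_assoc]
    congr 1
    exact I.proj_eq.2 (hI _ (.E1_source e))

lemma pathElement_mul_tgt (hI : ∀ x, CohnRel E x → x ∈ I.carrier)
    (x : FinPath E) :
    (pathElement x * pathElement (ofVertex x.tgt) : I.Quotient) = pathElement x := by
  induction x using FinPath.inductionOn with
  | vertex a => exact pathElement_vertex_mul_self hI a
  | cons e z h ih => rw [pathElement_cons hI, tgt_concat, mul_assoc, ih]

/-- The target projection of `x` and the source projection of `z` can be inserted between the
factors, and they are orthogonal. -/
lemma pathElement_mul_of_ne (hI : ∀ x, CohnRel E x → x ∈ I.carrier)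
    {x z : FinPath E} (h : x.tgt ≠ z.src) :
    (pathElement x * pathElement z : I.Quotient) = 0 := by
  rw [← pathElement_mul_tgt hI x, ← pathElement_src_mul hI z, mul_assoc,
    ← mul_assoc (pathElement (ofVertex x.tgt)), pathElement_vertex_mul_of_ne hI h, zero_mul,
    mul_zero]

lemma pathElement_concat (hI : ∀ x, CohnRel E x → x ∈ I.carrier)
    (x z : FinPath E) (h : x.tgt = z.src) :
    (pathElement (x.concat z h) : I.Quotient) = pathElement x * pathElement z := by
  induction x using FinPath.inductionOn with
  | vertex a =>
    obtain rfl : a = z.src := h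
    rw [pathElement_src_mul hI]
    rfl
  | cons e y h' ih =>
    rw [tgt_concat] at h
    have h1 : (ofEdge e).tgt = (y.concat z h).src := h'
    have h2 : ((ofEdge e).concat y h').concat z ((tgt_concat _ _ _).trans h) =
        (ofEdge e).concat (y.concat z h) h1 := by
      ext1
      · rfl
      · exact List.append_assoc _ _ _
    rw [h2, pathElement_cons hI, pathElement_cons hI, ih h, mul_assoc]

lemma star_pathElement_ofEdge_mul_self (hI : ∀ x, CohnRel E x → x ∈ I.carrier)
    (e : E.Edge) :
    (star (pathElement (ofEdge e)) * pathElement (ofEdge e) : I.Quotient) =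
      pathElement (ofVertex (E.t e)) := by
  rw [← proj_gen_ghost]
  exact I.proj_eq.2 (hI _ (.CK1_same e))

lemma star_pathElement_ofEdge_mul_of_ne (hI : ∀ x, CohnRel E x → x ∈ I.carrier)
    {e e' : E.Edge} (h : e ≠ e') :
    (star (pathElement (ofEdge e)) * pathElement (ofEdge e') : I.Quotient) = 0 := by
  rw [← proj_gen_ghost]
  exact I.proj_eq_zero.2 (hI _ (.CK1_ne e e' h))

/-- The common first edge cancels by (CK1). What remains is its target projection, which the source
of `z'` absorbs. This is the inductive step for all products `S_x* S_x'`. -/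
lemma star_pathElement_cons_mul_cons (hI : ∀ x, CohnRel E x → x ∈ I.carrier)
    (e : E.Edge) {z z' : FinPath E}
    (h : (ofEdge e).tgt = z.src) (h' : (ofEdge e).tgt = z'.src) :
    (star (pathElement ((ofEdge e).concat z h)) * pathElement ((ofEdge e).concat z' h') :
      I.Quotient) = star (pathElement z) * pathElement z' := by
  rw [pathElement_cons hI, pathElement_cons hI, StarIdeal.quotient_star_mul, mul_assoc,
    ← mul_assoc (star (pathElement (ofEdge e))), star_pathElement_ofEdge_mul_self hI]
  have h1 : E.t e = z'.src := h'
  rw [h1, pathElement_src_mul hI]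

lemma star_pathElement_mul_self (hI : ∀ x, CohnRel E x → x ∈ I.carrier)
    (x : FinPath E) :
    (star (pathElement x) * pathElement x : I.Quotient) = pathElement (ofVertex x.tgt) := by
  induction x using FinPath.inductionOn with
  | vertex a =>
    rw [star_pathElement_ofVertex]
    exact pathElement_vertex_mul_self hI a
  | cons e z h ih => rw [star_pathElement_cons_mul_cons hI, ih, tgt_concat]

/-- Common first edges are cancelled one at a time. For incomparable paths this ends either with two
different first edges, where (CK1) gives zero, or with a vertex facing a path from another source,
where orthogonality of the vertex projections does. -/
lemma star_pathElement_mul_of_not_comparable (hI : ∀ x, CohnRel E x → x ∈ I.carrier)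
    {x x' : FinPath E} (h : ¬ Comparable x x') :
    (star (pathElement x) * pathElement x' : I.Quotient) = 0 := by
  induction x using FinPath.inductionOn generalizing x' with
  | vertex a =>
    rw [star_pathElement_ofVertex]
    exact pathElement_mul_of_ne hI fun ha => h (Or.inl (isInitial_ofVertex ha))
  | cons e z hz ih =>
    induction x' using FinPath.inductionOn with
    | vertex a =>
      -- The adjoint of the product is a product of paths that do not compose.
      rw [← star_pathElement_ofVertex, ← StarIdeal.quotient_star_mul,
        pathElement_mul_of_ne hI, StarIdeal.quotient_star_zero]
      exact fun ha => h (Or.inr (isInitial_ofVertex ha))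
    | cons e' z' hz' _ =>
      by_cases he : e = e'
      · subst he
        rw [star_pathElement_cons_mul_cons hI]
        exact ih fun hc => h ((comparable_concat_concat _ _).2 hc)
      · rw [pathElement_cons hI, pathElement_cons hI, StarIdeal.quotient_star_mul, mul_assoc,
          ← mul_assoc (star (pathElement (ofEdge e))), star_pathElement_ofEdge_mul_of_ne hI he,
          zero_mul, mul_zero]

lemma pathElement_mul_star_of_ne (hI : ∀ x, CohnRel E x → x ∈ I.carrier)
    {x x' : FinPath E} (h : x.tgt ≠ x'.tgt) :
    (pathElement x * star (pathElement x') : I.Quotient) = 0 := by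
  rw [← pathElement_mul_tgt hI x', StarIdeal.quotient_star_mul, star_pathElement_ofVertex,
    ← mul_assoc, pathElement_mul_of_ne hI (z := ofVertex x'.tgt) h, zero_mul]

end PathElement

/-! ### Universal property of the presented *-algebras. -/

section Lift

variable {A : Type w} [NonUnitalRing A] [Module ℂ A] [IsScalarTower ℂ A A] [SMulCommClass ℂ A A]
  [StarRing A] [StarModule ℂ A]
variable {B : Type*} [NonUnitalRing B] [Module ℂ B] [IsScalarTower ℂ B B] [SMulCommClass ℂ B B]
  [StarRing B] [StarModule ℂ B]

/-- A *-homomorphism that vanishes on a *-ideal factors through the quotient. -/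
def StarIdeal.lift (J : StarIdeal A) (f : A →⋆ₙₐ[ℂ] B) (hf : ∀ x ∈ J.carrier, f x = 0) :
    J.Quotient →⋆ₙₐ[ℂ] B where
  toFun := J.carrier.liftQ (f : A →ₗ[ℂ] B) hf
  map_smul' c a := map_smul (J.carrier.liftQ (f : A →ₗ[ℂ] B) hf) c a
  map_zero' := map_zero (J.carrier.liftQ (f : A →ₗ[ℂ] B) hf)
  map_add' a b := map_add (J.carrier.liftQ (f : A →ₗ[ℂ] B) hf) a b
  map_mul' a b := by
    obtain ⟨a, rfl⟩ := J.proj_surjective a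
    obtain ⟨b, rfl⟩ := J.proj_surjective b
    exact map_mul f a b
  map_star' a := by
    obtain ⟨a, rfl⟩ := J.proj_surjective a
    exact map_star f a

/-- A *-homomorphism that vanishes on a set vanishes on the *-ideal it generates. -/
lemma StarIdeal.map_eq_zero_of_mem_span {S : Set A} (hS : ∀ x ∈ S, star x ∈ S) (f : A →⋆ₙₐ[ℂ] B)
    (hf : ∀ x ∈ S, f x = 0) (x : A) (hx : x ∈ (StarIdeal.span S hS).carrier) : f x = 0 := by
  simp only [StarIdeal.span, Submodule.mem_sInf] at hx
  -- The span is the infimum of the two-sided ideals that contain `S`, and the kernel of `f` is one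
  -- of them.
  exact hx (LinearMap.ker (f : A →ₗ[ℂ] B))
    ⟨fun y hy => hf y hy, fun y hy a => by
      have hy' : f y = 0 := hy
      exact ⟨show f (a * y) = 0 by rw [map_mul, hy', mul_zero],
        show f (y * a) = 0 by rw [map_mul, hy', zero_mul]⟩⟩

/-- The *-homomorphism on the free *-algebra determined by its values on the generators. -/
def freeLift (φ : Gen E → B) (hφ : ∀ g, φ (star g) = star (φ g)) : FreeAlg E →⋆ₙₐ[ℂ] B :=
  { MonoidAlgebra.liftMagma ℂ (FreeSemigroup.lift φ) with
    map_star' := fun a => by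
      change MonoidAlgebra.liftMagma ℂ (FreeSemigroup.lift φ) (star a) =
        star (MonoidAlgebra.liftMagma ℂ (FreeSemigroup.lift φ) a)
      induction a using MonoidAlgebra.induction_linear with
      | zero => simp
      | add a b ha hb => simp only [star_add, map_add, ha, hb]
      | single m c =>
        -- Compatibility with the involution passes from letters to words, because both involutions
        -- reverse products.
        have h : FreeSemigroup.lift φ (star m) = star (FreeSemigroup.lift φ m) := by
          induction m using FreeSemigroup.recOnMul with
          | ih1 x => simp [FreeSemigroup.star_of, hφ]
          | ih2 x y hx hy => simp only [star_mul, map_mul, hx, hy]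
        simp [star_single, h] }

lemma freeLift_gen (φ : Gen E → B) (hφ : ∀ g, φ (star g) = star (φ g)) (g : Gen E) :
    freeLift φ hφ (gen g) = φ g := by
  change MonoidAlgebra.liftMagma ℂ (FreeSemigroup.lift φ) (gen g) = φ g
  simp [gen]

/-- A *-homomorphism on a quotient of the free *-algebra is determined by its values on the
generators. -/
lemma hom_ext_gen {J : StarIdeal (FreeAlg E)} {ρ σ : J.Quotient →⋆ₙₐ[ℂ] B}
    (h : ∀ g, ρ (J.proj (gen g)) = σ (J.proj (gen g))) : ρ = σ := by
  apply NonUnitalStarAlgHom.ext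
  intro a
  obtain ⟨a, rfl⟩ := J.proj_surjective a
  induction a using MonoidAlgebra.induction_linear with
  | zero => rw [J.proj_zero, map_zero, map_zero]
  | add a b ha hb => rw [J.proj_add, map_add, map_add, ha, hb]
  | single m c =>
    have h1 : (MonoidAlgebra.single m c : FreeAlg E) = c • MonoidAlgebra.single m 1 := by simp
    rw [h1, J.proj_smul, map_smul, map_smul]
    congr 1
    induction m using FreeSemigroup.recOnMul with
    | ih1 g => exact h g
    | ih2 g m hg hm =>
      have h2 : (MonoidAlgebra.single (FreeSemigroup.of g * m) 1 : FreeAlg E) =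
          MonoidAlgebra.single (FreeSemigroup.of g) 1 * MonoidAlgebra.single m 1 := by
        simp [MonoidAlgebra.single_mul_single]
      -- The hypothesis `h1` depends on the word, so the induction hypotheses take it as a premise,
      -- which `simp` discharges.
      rw [h2, J.proj_mul, map_mul, map_mul, hg (by simp), hm (by simp)]

end Lift

lemma mem_toFinset_emitted {b : E.V} (hb : E.IsRegular b) {e : E.Edge} :
    e ∈ hb.2.toFinset ↔ E.s e = b := Set.Finite.mem_toFinset _

lemma mem_toFinset_preimage {R : RelMorphism E F} (hR : R.IsProper) {y : FinPath F}
    {x : FinPath E} : x ∈ (hR y).toFinset ↔ R.rel x y := Set.Finite.mem_toFinset _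

/-! ### Iterated Cuntz–Krieger relation along a finite antichain. -/

section CuntzKrieger

open Classical in
/-- In a Leavitt path algebra, the range projection of a path `p` is the sum of the range
projections of the members of any finite antichain of extensions of `p` that meets all
extensions of `p`. -/
lemma pathElement_mul_star_eq_sum {I : StarIdeal (FreeAlg E)}
    (hI : ∀ x, LeavittRel E x → x ∈ I.carrier) (n : ℕ) : ∀ (p : FinPath E)
    (X : Finset (FinPath E)), (∀ x ∈ X, IsInitial p x) →
    (∀ x ∈ X, x.edges.length ≤ p.edges.length + n) →
    (∀ x ∈ X, ∀ y ∈ X, IsInitial x y → x = y) →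
    (∀ z, IsInitial p z → ∃ x ∈ X, Comparable z x) →
    (pathElement p * star (pathElement p) : I.Quotient) =
      ∑ x ∈ X, pathElement x * star (pathElement x) := by
  have hI' : ∀ x, CohnRel E x → x ∈ I.carrier := fun x hx => hI x (.cohn x hx)
  induction n with
  -- The parameter `n` bounds how far the members of `X` extend beyond `p`. For `n = 0` they all
  -- equal `p`, and `X` is not empty because some member is comparable to `p`.
  | zero =>
    intro p X hp hlen hanti hex
    have hX : ∀ x ∈ X, x = p := fun x hx => by
      have h := isInitial_iff.1 (hp x hx)
      exact (FinPath.ext h.1 (h.2.eq_of_length_le (hlen x hx))).symm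
    obtain ⟨x, hx, -⟩ := hex p (IsInitial.refl p)
    have hXp : X = {p} := Finset.eq_singleton_iff_unique_mem.2 ⟨hX x hx ▸ hx, hX⟩
    rw [hXp, Finset.sum_singleton]
  | succ n ih =>
    intro p X hp hlen hanti hex
    by_cases hpX : p ∈ X
    · have hXp : X = {p} := Finset.eq_singleton_iff_unique_mem.2
        ⟨hpX, fun x hx => (hanti p hpX x hx (hp x hx)).symm⟩
      rw [hXp, Finset.sum_singleton]
    -- From here on `p ∉ X`. A member of `X` comparable to a path through `p e` cannot stop before
    -- the end of `p e`: it would be an initial subpath of `p` and an extension of `p`, hence `p`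
    -- itself. So restricting `X` to the extensions of `p e` preserves the covering property.
    have hstep : ∀ (e : E.Edge) (h : p.tgt = (ofEdge e).src) (z x : FinPath E),
        IsInitial (p.concat (ofEdge e) h) z → x ∈ X → Comparable z x →
        IsInitial (p.concat (ofEdge e) h) x := by
      intro e h z x hz hx hc
      have hc' : Comparable (p.concat (ofEdge e) h) x := by
        rcases hc with hc | hc
        · exact Or.inl (hz.trans hc)
        · exact comparable_of_isInitial hz hc
      rcases hc' with h1 | h1
      · exact h1
      · rcases List.prefix_concat_iff.1 (isInitial_iff.1 h1).2 with h3 | h3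
        · rw [FinPath.ext (isInitial_iff.1 h1).1 h3]
          exact IsInitial.refl _
        · have h4 : IsInitial x p := isInitial_iff.2 ⟨(isInitial_iff.1 h1).1, h3⟩
          exact absurd ((hp x hx).antisymm h4 ▸ hx) hpX
    have hnext : ∀ x ∈ X, ∃ (e : E.Edge) (h : p.tgt = (ofEdge e).src),
        IsInitial (p.concat (ofEdge e) h) x := by
      intro x hx
      obtain ⟨z, hz, rfl⟩ := hp x hx
      rcases hl : z.edges with _ | ⟨e, l⟩
      · refine absurd ?_ hpX
        have h : p.concat z hz = p := by ext1 <;> simp [hl]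
        exact h ▸ hx
      · obtain ⟨z', hz', rfl, -⟩ := exists_eq_cons hl
        exact ⟨e, hz, (isInitial_concat_concat _ _).2 (isInitial_concat _ _ hz')⟩
    -- Positions are counted from zero, so the entry at the length of `p` is the first edge after
    -- `p`. It sorts the members of `X` by the branch at the end of `p`.
    have hget : ∀ (e : E.Edge) (h : p.tgt = (ofEdge e).src) (x : FinPath E),
        IsInitial (p.concat (ofEdge e) h) x → x.edges[p.edges.length]? = some e := by
      intro e h x hx
      obtain ⟨l, hl⟩ := (isInitial_iff.1 hx).2
      simp [← hl]
    have hreg : E.IsRegular p.tgt := by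
      constructor
      · obtain ⟨x, hx, -⟩ := hex p (IsInitial.refl p)
        obtain ⟨e, h, -⟩ := hnext x hx
        exact ⟨e, h.symm⟩
      -- Every edge that starts at the end of `p` is the next edge of some member of the finite set
      -- `X`. The image under `some` matches the optional entry of the list.
      · refine Set.Finite.of_finite_image (f := some) ?_ (Option.some_injective _).injOn
        refine (X.finite_toSet.image fun x => x.edges[p.edges.length]?).subset ?_
        rintro _ ⟨e, he, rfl⟩
        have h : p.tgt = (ofEdge e).src := Eq.symm he
        obtain ⟨x, hx, hc⟩ := hex _ (isInitial_concat p _ h)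
        exact ⟨x, hx, hget e h x (hstep e h _ x (IsInitial.refl _) hx hc)⟩
    have hck : (pathElement (ofVertex p.tgt) : I.Quotient) =
        ∑ e ∈ hreg.2.toFinset, pathElement (ofEdge e) * star (pathElement (ofEdge e)) := by
      have h := I.proj_eq.2 (hI _ (.CK2 _ hreg))
      rw [pathElement_ofVertex, h]
      change I.carrier.mkQ _ = _
      rw [map_sum]
      refine Finset.sum_congr rfl fun e _ => ?_
      rw [← proj_gen_ghost]
      rfl
    calc (pathElement p * star (pathElement p) : I.Quotient)
        = pathElement p * pathElement (ofVertex p.tgt) * star (pathElement p) := by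
          rw [pathElement_mul_tgt hI']
      _ = ∑ e ∈ hreg.2.toFinset, pathElement p *
            (pathElement (ofEdge e) * star (pathElement (ofEdge e))) * star (pathElement p) := by
          rw [hck, Finset.mul_sum, Finset.sum_mul]
      -- Each summand is the range projection of `p e`. By induction it is the sum over those
      -- members of `X` that extend `p e`, written here with an indicator so that the two sums can
      -- be exchanged.
      _ = ∑ e ∈ hreg.2.toFinset, ∑ x ∈ X,
            if x.edges[p.edges.length]? = some e then
              pathElement x * star (pathElement x) else 0 := by
          refine Finset.sum_congr rfl fun e he => ?_
          have h : p.tgt = (ofEdge e).src := ((mem_toFinset_emitted hreg).1 he).symm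
          rw [← Finset.sum_filter]
          have hfilter : ∀ x, x ∈ X.filter (fun x => x.edges[p.edges.length]? = some e) ↔
              x ∈ X ∧ IsInitial (p.concat (ofEdge e) h) x := by
            intro x
            rw [Finset.mem_filter]
            refine and_congr_right fun hx => ⟨fun hxe => ?_, hget e h x⟩
            obtain ⟨e', h', hx'⟩ := hnext x hx
            obtain rfl := Option.some_injective _ ((hget e' h' x hx').symm.trans hxe)
            exact hx'
          rw [← ih (p.concat (ofEdge e) h)]
          · rw [pathElement_concat hI', StarIdeal.quotient_star_mul]
            simp only [mul_assoc]
          · exact fun x hx => ((hfilter x).1 hx).2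
          · intro x hx
            have := hlen x ((hfilter x).1 hx).1
            simp only [edges_concat, edges_ofEdge, List.length_append, List.length_singleton]
            omega
          · exact fun x hx y hy => hanti x ((hfilter x).1 hx).1 y ((hfilter y).1 hy).1
          · intro z hz
            obtain ⟨x, hx, hc⟩ := hex z ((isInitial_concat p _ h).trans hz)
            exact ⟨x, (hfilter x).2 ⟨hx, hstep e h z x hz hx hc⟩, hc⟩
      _ = ∑ x ∈ X, pathElement x * star (pathElement x) := by
          -- Each member of `X` has exactly one next edge after `p`, so exactly one term of its
          -- inner sum survives.
          rw [Finset.sum_comm]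
          refine Finset.sum_congr rfl fun x hx => ?_
          obtain ⟨e, h, hx'⟩ := hnext x hx
          rw [hget e h x hx', Finset.sum_eq_single e]
          · exact if_pos rfl
          · intro e' _ hne
            exact if_neg fun h' => hne (Option.some_injective _ h').symm
          · intro he
            exact absurd ((mem_toFinset_emitted hreg).2 h.symm) he

end CuntzKrieger

/-! ### Sums over relation preimages and the relations they satisfy. -/

section PathSum

/-- The sum of the elements `S_x` over the relation preimage of a path. -/
def pathSum (R : RelMorphism E F) (I : StarIdeal (FreeAlg E)) (y : FinPath F) : I.Quotient :=
  ∑ᶠ (x : FinPath E) (_ : x ∈ R.preimage y), (pathElement x : I.Quotient)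

variable {R : RelMorphism E F} {I : StarIdeal (FreeAlg E)}

lemma pathSum_eq (hR : R.IsProper) (y : FinPath F) :
    pathSum R I y = ∑ x ∈ (hR y).toFinset, pathElement x :=
  finsum_mem_eq_finite_toFinset_sum _ (hR y)

lemma StarIdeal.quotient_star_sum {ι : Type*} (s : Finset ι) (f : ι → I.Quotient) :
    star (∑ i ∈ s, f i) = ∑ i ∈ s, star (f i) := star_sum s f

lemma star_pathSum_eq (hR : R.IsProper) (y : FinPath F) :
    star (pathSum R I y) = ∑ x ∈ (hR y).toFinset, star (pathElement x : I.Quotient) := by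
  rw [pathSum_eq hR, StarIdeal.quotient_star_sum]

/-- Only vertices are related to vertices, so every summand is a self-adjoint vertex projection. -/
lemma star_pathSum_ofVertex (hR : R.IsProper) (b : F.V) :
    star (pathSum R I (ofVertex b)) = pathSum R I (ofVertex b) := by
  rw [star_pathSum_eq hR, pathSum_eq hR]
  refine Finset.sum_congr rfl fun x hx => ?_
  obtain ⟨a, rfl⟩ := R.vertex_of_vertex _ _ ((mem_toFinset_preimage hR).1 hx)
  exact star_pathElement_ofVertex a

/-- If a term survived, the common vertex of its two factors would be related both to the target of
`y` and to the source of `z`, against vertex disjointness. -/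
lemma pathSum_mul_of_ne (hI : ∀ x, CohnRel E x → x ∈ I.carrier) (hR : R.IsCRG)
    {y z : FinPath F} (h : y.tgt ≠ z.src) : pathSum R I y * pathSum R I z = 0 := by
  rw [pathSum_eq hR.proper, pathSum_eq hR.proper, Finset.sum_mul_sum]
  refine Finset.sum_eq_zero fun x hx => Finset.sum_eq_zero fun x' hx' =>
    pathElement_mul_of_ne hI fun hxx => h ?_
  have h1 := R.target _ _ ((mem_toFinset_preimage hR.proper).1 hx)
  rw [hxx] at h1
  exact hR.vertexDisjoint.eq h1 (R.source _ _ ((mem_toFinset_preimage hR.proper).1 hx'))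

-- Terms with non-composable factors vanish. On composable pairs, concatenation lands in the
-- preimage of `yz` by multiplicativity and is onto by decomposability. It is injective because the
-- first factors of equal concatenations are comparable and lie over the same path, hence are equal.
open Classical in
lemma pathSum_concat (hI : ∀ x, CohnRel E x → x ∈ I.carrier) (hR : R.IsCRG)
    (y z : FinPath F) (h : y.tgt = z.src) :
    pathSum R I (y.concat z h) = pathSum R I y * pathSum R I z := by
  rw [pathSum_eq hR.proper, pathSum_eq hR.proper, pathSum_eq hR.proper, Finset.sum_mul_sum,
    ← Finset.sum_product']
  have h0 : ∀ p ∈ (hR.proper y).toFinset ×ˢ (hR.proper z).toFinset,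
      (pathElement p.1 * pathElement p.2 : I.Quotient) ≠ 0 → p.1.tgt = p.2.src :=
    fun p _ hp => by_contra fun hne => hp (pathElement_mul_of_ne hI hne)
  rw [← Finset.sum_filter_of_ne h0]
  symm
  refine Finset.sum_bij (fun p hp => p.1.concat p.2 (Finset.mem_filter.1 hp).2) ?_ ?_ ?_ ?_
  · rintro ⟨x, x'⟩ hp
    simp only [Finset.mem_filter, Finset.mem_product, mem_toFinset_preimage hR.proper] at hp ⊢
    exact hR.mult _ _ _ _ hp.2 h hp.1.1 hp.1.2
  · rintro ⟨x, x'⟩ hp ⟨w, w'⟩ hq heq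
    simp only [Finset.mem_filter, Finset.mem_product, mem_toFinset_preimage hR.proper] at hp hq heq
    have h1 : x = w := by
      rcases Comparable.left (Or.inl (heq ▸ IsInitial.refl _) :
        Comparable (x.concat x' hp.2) (w.concat w' hq.2)) with h1 | h1
      · exact hR.eq_of_isInitial hp.1.1 hq.1.1 h1
      · exact (hR.eq_of_isInitial hq.1.1 hp.1.1 h1).symm
    subst h1
    have h2 : x' = w' := by
      ext1
      · exact hp.2.symm.trans hq.2
      · exact List.append_cancel_left (congrArg FinPath.edges heq)
    rw [h2]
  · intro x hx
    obtain ⟨x1, x2, h12, hx1, hx2, rfl⟩ :=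
      hR.decomposable _ _ h _ ((mem_toFinset_preimage hR.proper).1 hx)
    refine ⟨(x1, x2), ?_, rfl⟩
    simp only [Finset.mem_filter, Finset.mem_product, mem_toFinset_preimage hR.proper]
    exact ⟨⟨hx1, hx2⟩, h12⟩
  · rintro ⟨x, x'⟩ hp
    exact (pathElement_concat hI _ _ _).symm

/-- A nonzero term would need comparable paths over `f` and `f'`, which monotonicity excludes for
different edges. -/
lemma star_pathSum_ofEdge_mul_of_ne (hI : ∀ x, CohnRel E x → x ∈ I.carrier) (hR : R.IsCRG)
    {f f' : F.Edge} (h : f ≠ f') :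
    star (pathSum R I (ofEdge f)) * pathSum R I (ofEdge f') = 0 := by
  rw [star_pathSum_eq hR.proper, pathSum_eq hR.proper, Finset.sum_mul_sum]
  refine Finset.sum_eq_zero fun x hx => Finset.sum_eq_zero fun x' hx' =>
    star_pathElement_mul_of_not_comparable hI fun hc => h ?_
  rw [mem_toFinset_preimage hR.proper] at hx hx'
  rcases hc with hc | hc
  · exact (hR.monotone _ _ _ _ hx hx' hc).2
  · exact (hR.monotone _ _ _ _ hx' hx hc).2.symm

/-- Monotonicity makes the preimages of `f` pairwise incomparable, so the double sum reduces to its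
diagonal terms `S_{t(x)}`. The target bijection of condition (5) then reindexes it by the preimages
of `t(f)`. -/
lemma star_pathSum_ofEdge_mul_self (hI : ∀ x, CohnRel E x → x ∈ I.carrier) (hR : R.IsCRG)
    (f : F.Edge) :
    star (pathSum R I (ofEdge f)) * pathSum R I (ofEdge f) = pathSum R I (ofVertex (F.t f)) := by
  rw [star_pathSum_eq hR.proper, pathSum_eq hR.proper, pathSum_eq hR.proper, Finset.sum_mul_sum]
  have h1 : ∀ x ∈ (hR.proper (ofEdge f)).toFinset,
      ∑ x' ∈ (hR.proper (ofEdge f)).toFinset,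
        (star (pathElement x) * pathElement x' : I.Quotient) = pathElement (ofVertex x.tgt) := by
    intro x hx
    rw [Finset.sum_eq_single x, star_pathElement_mul_self hI]
    · intro x' hx' hne
      refine star_pathElement_mul_of_not_comparable hI fun hc => hne ?_
      rw [mem_toFinset_preimage hR.proper] at hx hx'
      rcases hc with hc | hc
      · exact (hR.monotone _ _ _ _ hx hx' hc).1.symm
      · exact (hR.monotone _ _ _ _ hx' hx hc).1
    · exact fun h => absurd hx h
  rw [Finset.sum_congr rfl h1]
  refine Finset.sum_bij (fun x _ => ofVertex x.tgt) ?_ ?_ ?_ ?_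
  · intro x hx
    rw [mem_toFinset_preimage hR.proper] at hx ⊢
    exact R.target _ _ hx
  · intro x hx x' hx' h
    rw [mem_toFinset_preimage hR.proper] at hx hx'
    exact hR.targetInjective f hx hx' (ofVertex_injective h)
  · intro a ha
    obtain ⟨x, hx, hxa⟩ := hR.targetSurjective f ((mem_toFinset_preimage hR.proper).1 ha)
    exact ⟨x, (mem_toFinset_preimage hR.proper).2 hx, hxa⟩
  · exact fun _ _ => rfl

/-- Distinct preimages of `f` have distinct targets, which kills the off-diagonal terms. -/
lemma pathSum_ofEdge_mul_star (hI : ∀ x, CohnRel E x → x ∈ I.carrier) (hR : R.IsCRG)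
    (f : F.Edge) :
    pathSum R I (ofEdge f) * star (pathSum R I (ofEdge f)) =
      ∑ x ∈ (hR.proper (ofEdge f)).toFinset, pathElement x * star (pathElement x) := by
  rw [star_pathSum_eq hR.proper, pathSum_eq hR.proper, Finset.sum_mul_sum]
  refine Finset.sum_congr rfl fun x hx => ?_
  rw [Finset.sum_eq_single x]
  · intro x' hx' hne
    refine pathElement_mul_star_of_ne hI fun h => hne ?_
    rw [mem_toFinset_preimage hR.proper] at hx hx'
    exact hR.targetInjective f hx' hx h.symm
  · exact fun h => absurd hx h

open Classical in
/-- The relation (CK2) for the images of the generators under an admissible relation morphism. -/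
lemma pathSum_ofVertex_eq_sum (hI : ∀ x, LeavittRel E x → x ∈ I.carrier) (hR : R.IsAdmissible)
    (b : F.V) (hb : F.IsRegular b) :
    pathSum R I (ofVertex b) = ∑ f ∈ hb.2.toFinset,
      pathSum R I (ofEdge f) * star (pathSum R I (ofEdge f)) := by
  have hI' : ∀ x, CohnRel E x → x ∈ I.carrier := fun x hx => hI x (.cohn x hx)
  have hC := hR.toIsCRG
  simp only [pathSum_ofEdge_mul_star hI' hC]
  have hmem : ∀ y, y ∈ hb.2.toFinset.biUnion (fun f => (hC.proper (ofEdge f)).toFinset) ↔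
      ∃ f, F.s f = b ∧ R.rel y (ofEdge f) := by
    intro y
    simp only [Finset.mem_biUnion, mem_toFinset_emitted hb, mem_toFinset_preimage hC.proper]
  have hmaps : ∀ y ∈ hb.2.toFinset.biUnion (fun f => (hC.proper (ofEdge f)).toFinset),
      ofVertex y.src ∈ (hC.proper (ofVertex b)).toFinset := by
    intro y hy
    obtain ⟨f, rfl, hf⟩ := (hmem y).1 hy
    exact (mem_toFinset_preimage hC.proper).2 (R.source _ _ hf)
  -- The double sum becomes one sum over all paths related to edges starting at `b`. It is then
  -- grouped by the source of the path, which is related to `b`.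
  rw [← Finset.sum_biUnion]
  · rw [pathSum_eq hC.proper, ← Finset.sum_fiberwise_of_maps_to hmaps]
    · refine Finset.sum_congr rfl fun x hx => ?_
      have hx' : R.rel x (ofVertex b) := (mem_toFinset_preimage hC.proper).1 hx
      obtain ⟨a, rfl⟩ := R.vertex_of_vertex _ _ hx'
      have h1 : (pathElement (ofVertex a) : I.Quotient) =
          pathElement (ofVertex a) * star (pathElement (ofVertex a)) := by
        rw [star_pathElement_ofVertex, pathElement_vertex_mul_self hI']
      set X := (hb.2.toFinset.biUnion fun f => (hC.proper (ofEdge f)).toFinset).filter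
        (fun y => ofVertex y.src = ofVertex a) with hX
      have hmemX : ∀ y, y ∈ X ↔ (∃ f, F.s f = b ∧ R.rel y (ofEdge f)) ∧ y.src = a := by
        intro y
        rw [hX, Finset.mem_filter, hmem, ofVertex_injective.eq_iff]
      rw [h1]
      -- Since the vertex `a` has length zero, the maximal length in `X` serves as the bound.
      -- Monotonicity makes `X` an antichain, and regularity of `R` makes it meet all paths from
      -- `a`.
      refine pathElement_mul_star_eq_sum hI (X.sup fun y => y.edges.length) _ X ?_ ?_ ?_ ?_
      · exact fun y hy => isInitial_ofVertex ((hmemX y).1 hy).2.symm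
      · intro y hy
        have := Finset.le_sup (f := fun y : FinPath E => y.edges.length) hy
        simpa using this
      · intro y hy y' hy' h
        obtain ⟨⟨f, -, hf⟩, -⟩ := (hmemX y).1 hy
        obtain ⟨⟨f', -, hf'⟩, -⟩ := (hmemX y').1 hy'
        exact (hC.monotone _ _ _ _ hf hf' h).1
      · intro z hz
        have hza : z.src = a := (isInitial_iff.1 hz).1.symm
        obtain ⟨y, f, hf, hs, hc⟩ := hR.regular b a z hb hx' hza
        exact ⟨y, (hmemX y).2 ⟨⟨f, hs, hf⟩, hc.src_eq.symm.trans hza⟩, hc⟩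
  -- No path is related to two different edges: monotonicity is applied to the path and itself.
  · intro f _ f' _ hne
    refine Finset.disjoint_left.2 fun y hy hy' => hne ?_
    rw [mem_toFinset_preimage hC.proper] at hy hy'
    exact (hC.monotone _ _ _ _ hy hy' (IsInitial.refl y)).2

open Classical in
/-- The relation preimages of a path under a composition, grouped by the intermediate path. -/
lemma sum_pathSum {S : RelMorphism F G} (hR : R.IsCRG) (hS : S.IsCRG) (z : FinPath G) :
    ∑ y ∈ (hS.proper z).toFinset, pathSum R I y = pathSum (R.comp S) I z := by
  simp only [pathSum_eq hR.proper, pathSum_eq (hR.comp hS).proper]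
  rw [← Finset.sum_biUnion]
  · refine Finset.sum_congr (Finset.ext fun x => ?_) fun _ _ => rfl
    simp only [Finset.mem_biUnion, mem_toFinset_preimage hS.proper,
      mem_toFinset_preimage hR.proper, mem_toFinset_preimage (hR.comp hS).proper]
    exact exists_congr fun y => and_comm
  -- A path related to both `y` and `y'` makes them comparable. Both are related to `z`, and the
  -- paths related to `z` are pairwise incomparable. So no path is counted twice.
  · intro y hy y' hy' hne
    refine Finset.disjoint_left.2 fun x hx hx' => hne ?_
    rw [mem_toFinset_preimage hR.proper] at hx hx'
    have hy1 : S.rel y z := (mem_toFinset_preimage hS.proper).1 hy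
    have hy2 : S.rel y' z := (mem_toFinset_preimage hS.proper).1 hy'
    rcases hR.comparable hx hx' (Or.inl (IsInitial.refl x)) with h | h
    · exact hS.eq_of_isInitial hy1 hy2 h
    · exact (hS.eq_of_isInitial hy2 hy1 h).symm

end PathSum

/-! ### Existence, uniqueness and composition of the induced homomorphisms. -/

section Induced

variable {R : RelMorphism E F} {I : StarIdeal (FreeAlg E)} {J : StarIdeal (FreeAlg F)}

/-- The formula for the adjoints of the edges follows from the one for the edges. -/
lemma isInduced_of_vertex_edge (hR : R.IsProper) {ρ : J.Quotient →⋆ₙₐ[ℂ] I.Quotient}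
    (hv : ∀ b, ρ (J.proj (gen (.vertex b))) = pathSum R I (ofVertex b))
    (he : ∀ f, ρ (J.proj (gen (.edge f))) = pathSum R I (ofEdge f)) : IsInduced R ρ where
  vertex := hv
  edge := he
  ghost f := by
    have h : ρ (J.proj (gen (.ghost f))) = star (ρ (J.proj (gen (.edge f)))) := by
      rw [proj_gen_ghost]
      exact map_star ρ _
    rw [h, he, star_pathSum_eq hR]
    exact (finsum_mem_eq_finite_toFinset_sum _ (hR (ofEdge f))).symm

lemma IsInduced.eq {ρ σ : J.Quotient →⋆ₙₐ[ℂ] I.Quotient} (hρ : IsInduced R ρ)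
    (hσ : IsInduced R σ) : ρ = σ := by
  refine hom_ext_gen fun g => ?_
  cases g with
  | vertex b => rw [hρ.vertex, hσ.vertex]
  | edge f => rw [hρ.edge, hσ.edge]
  | ghost f => rw [hρ.ghost, hσ.ghost]

/-- The defining formula covers vertices and edges only; multiplicativity of `pathSum` extends it to
all paths. Composition needs this, since an edge may be related to a path of any positive or zero
length. -/
lemma IsInduced.map_pathElement (hI : ∀ x, CohnRel E x → x ∈ I.carrier)
    (hJ : ∀ x, CohnRel F x → x ∈ J.carrier) (hR : R.IsCRG)
    {ρ : J.Quotient →⋆ₙₐ[ℂ] I.Quotient} (hρ : IsInduced R ρ) (y : FinPath F) :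
    ρ (pathElement y) = pathSum R I y := by
  induction y using FinPath.inductionOn with
  | vertex b => exact hρ.vertex b
  | cons f z h ih =>
    rw [pathElement_cons hJ, map_mul, ih, pathSum_concat hI hR]
    congr 1
    exact hρ.edge f

/-- Applying `ρ` to the sum of the `S_y` over `S⁻¹(z)` gives the sum of their path sums, which
collapses to a sum over the preimage under the composite relation. -/
lemma IsInduced.comp {S : RelMorphism F G} {K : StarIdeal (FreeAlg G)}
    (hI : ∀ x, CohnRel E x → x ∈ I.carrier) (hJ : ∀ x, CohnRel F x → x ∈ J.carrier)
    (hR : R.IsCRG) (hS : S.IsCRG) {ρ : J.Quotient →⋆ₙₐ[ℂ] I.Quotient}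
    {σ : K.Quotient →⋆ₙₐ[ℂ] J.Quotient} (hρ : IsInduced R ρ) (hσ : IsInduced S σ) :
    IsInduced (R.comp S) (ρ.comp σ) := by
  have key : ∀ z, ρ (pathSum S J z) = pathSum (R.comp S) I z := by
    intro z
    rw [pathSum_eq hS.proper, map_sum, ← sum_pathSum hR hS]
    exact Finset.sum_congr rfl fun y _ => hρ.map_pathElement hI hJ hR y
  refine isInduced_of_vertex_edge (hR.comp hS).proper (fun c => ?_) fun g => ?_
  · exact (congrArg ρ (hσ.vertex c)).trans (key _)
  · exact (congrArg ρ (hσ.edge g)).trans (key _)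

lemma pathSum_id (y : FinPath E) : pathSum (RelMorphism.id E) I y = pathElement y := by
  have h : (RelMorphism.id E).preimage y = {y} := rfl
  rw [pathSum, h, finsum_mem_singleton]

lemma isInduced_id : IsInduced (RelMorphism.id E) (NonUnitalStarAlgHom.id ℂ I.Quotient) :=
  isInduced_of_vertex_edge (RelMorphism.id_isAdmissible E).proper
    (fun a => (pathSum_id (ofVertex a)).symm) fun e => (pathSum_id (ofEdge e)).symm

/-- The images of the generators under the homomorphism induced by a relation morphism. -/
def genImage (R : RelMorphism E F) (I : StarIdeal (FreeAlg E)) : Gen F → I.Quotient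
  | .vertex b => pathSum R I (ofVertex b)
  | .edge f => pathSum R I (ofEdge f)
  | .ghost f => star (pathSum R I (ofEdge f))

lemma genImage_star (hR : R.IsProper) (g : Gen F) :
    genImage R I (star g) = star (genImage R I g) := by
  cases g with
  | vertex b => exact (star_pathSum_ofVertex hR b).symm
  | edge f => rfl
  | ghost f => exact (star_star (pathSum R I (ofEdge f))).symm

/-- The induced homomorphism on the free *-algebra. -/
def freeInduced (I : StarIdeal (FreeAlg E)) (hR : R.IsProper) : FreeAlg F →⋆ₙₐ[ℂ] I.Quotient :=
  freeLift (genImage R I) (genImage_star hR)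

lemma freeInduced_gen (hR : R.IsProper) (g : Gen F) :
    freeInduced I hR (gen g) = genImage R I g := freeLift_gen _ _ g

/-- Idempotence of the vertices and the source and target relations for edges are multiplicativity
of `pathSum` for concatenation with a path of length zero. Those for adjoints of edges follow by
applying the involution. Only orthogonality of vertices and (CK1) need the separate computations. -/
lemma freeInduced_eq_zero_of_cohnRel (hI : ∀ x, CohnRel E x → x ∈ I.carrier) (hR : R.IsCRG)
    (x : FreeAlg F) (hx : CohnRel F x) : freeInduced I hR.proper x = 0 := by
  have hsrc : ∀ y : FinPath F, pathSum R I (ofVertex y.src) * pathSum R I y = pathSum R I y :=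
    fun y => (pathSum_concat hI hR (ofVertex y.src) y rfl).symm
  have htgt : ∀ y : FinPath F, pathSum R I y * pathSum R I (ofVertex y.tgt) = pathSum R I y := by
    intro y
    rw [← pathSum_concat hI hR y (ofVertex y.tgt) rfl]
    congr 1
    ext1
    · rfl
    · exact List.append_nil _
  cases hx with
  | V_same a =>
    rw [map_sub, map_mul, freeInduced_gen, sub_eq_zero]
    exact hsrc (ofVertex a)
  | V_ne a b h =>
    rw [map_mul, freeInduced_gen, freeInduced_gen]
    exact pathSum_mul_of_ne hI hR h
  | E1_source e =>
    rw [map_sub, map_mul, freeInduced_gen, freeInduced_gen, sub_eq_zero]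
    exact hsrc (ofEdge e)
  | E1_target e =>
    rw [map_sub, map_mul, freeInduced_gen, freeInduced_gen, sub_eq_zero]
    exact htgt (ofEdge e)
  | E2_target e =>
    rw [map_sub, map_mul, freeInduced_gen, freeInduced_gen, sub_eq_zero]
    have h := congrArg star (htgt (ofEdge e))
    rw [StarIdeal.quotient_star_mul, star_pathSum_ofVertex hR.proper] at h
    exact h
  | E2_source e =>
    rw [map_sub, map_mul, freeInduced_gen, freeInduced_gen, sub_eq_zero]
    have h := congrArg star (hsrc (ofEdge e))
    rw [StarIdeal.quotient_star_mul, star_pathSum_ofVertex hR.proper] at h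
    exact h
  | CK1_same e =>
    rw [map_sub, map_mul, freeInduced_gen, freeInduced_gen, freeInduced_gen, sub_eq_zero]
    exact star_pathSum_ofEdge_mul_self hI hR e
  | CK1_ne e e' h =>
    rw [map_mul, freeInduced_gen, freeInduced_gen]
    exact star_pathSum_ofEdge_mul_of_ne hI hR h

lemma exists_isInduced_of_freeInduced (hR : R.IsProper)
    (h : ∀ x ∈ J.carrier, freeInduced I hR x = 0) :
    ∃ ρ : J.Quotient →⋆ₙₐ[ℂ] I.Quotient, IsInduced R ρ :=
  ⟨J.lift (freeInduced I hR) h, isInduced_of_vertex_edge hR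
    (fun b => freeInduced_gen hR (.vertex b)) fun f => freeInduced_gen hR (.edge f)⟩

lemma exists_isInduced_cohn (hR : R.IsCRG) :
    ∃ ρ : CohnPathAlgebra F →⋆ₙₐ[ℂ] CohnPathAlgebra E, IsInduced R ρ :=
  exists_isInduced_of_freeInduced hR.proper <|
    StarIdeal.map_eq_zero_of_mem_span (fun _ h => CohnRel.star h) _ <|
      freeInduced_eq_zero_of_cohnRel (fun _ => mem_cohnIdeal) hR

lemma exists_isInduced_leavitt (hR : R.IsAdmissible) :
    ∃ ρ : LeavittPathAlgebra F →⋆ₙₐ[ℂ] LeavittPathAlgebra E, IsInduced R ρ := by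
  refine exists_isInduced_of_freeInduced hR.proper <|
    StarIdeal.map_eq_zero_of_mem_span (fun _ h => LeavittRel.star h) _ ?_
  intro x hx
  cases hx with
  | cohn _ h =>
    exact freeInduced_eq_zero_of_cohnRel (fun x hx => mem_leavittIdeal (.cohn x hx)) hR.toIsCRG _ h
  -- The only relation for which admissibility beyond `CRG` is used.
  | CK2 b hb =>
    rw [map_sub, map_sum, freeInduced_gen, sub_eq_zero]
    refine (pathSum_ofVertex_eq_sum (fun _ => mem_leavittIdeal) hR b hb).trans ?_
    refine Finset.sum_congr rfl fun f _ => ?_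
    rw [map_mul, freeInduced_gen, freeInduced_gen]
    rfl

end Induced

/-! ### Functoriality of the universal enveloping C*-algebra. -/

section EnvelopeMap

variable {A B : Type w} [NonUnitalRing A] [Module ℂ A] [IsScalarTower ℂ A A] [SMulCommClass ℂ A A]
  [StarRing A] [StarModule ℂ A] [HasEnvelope A] [NonUnitalRing B] [Module ℂ B]
  [IsScalarTower ℂ B B] [SMulCommClass ℂ B B] [StarRing B] [StarModule ℂ B] [HasEnvelope B]

/-- The pullback of a C*-seminorm along a *-homomorphism. -/
def CStarSeminorm.comap (f : A →⋆ₙₐ[ℂ] B) (q : CStarSeminorm B) : CStarSeminorm A where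
  toSeminorm := q.toSeminorm.comp (f : A →ₗ[ℂ] B)
  mul_le' a b := by
    change q.toSeminorm (f (a * b)) ≤ q.toSeminorm (f a) * q.toSeminorm (f b)
    rw [map_mul]
    exact q.mul_le _ _
  cstar' a := by
    change q.toSeminorm (f (star a * a)) = q.toSeminorm (f a) * q.toSeminorm (f a)
    rw [map_mul, map_star]
    exact q.cstar _

/-- *-homomorphisms are contractive for the greatest C*-seminorms. -/
lemma universalSeminorm_map_le (f : A →⋆ₙₐ[ℂ] B) (a : A) :
    universalSeminorm (f a) ≤ universalSeminorm a :=
  -- Each C*-seminorm of the target, evaluated at `f a`, is the value at `a` of its pullback, one of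
  -- the seminorms in the supremum on the source.
  ciSup_le fun q => le_universalSeminorm (q.comap f) a

/-- A *-homomorphism as a bounded homomorphism for the greatest C*-seminorms. -/
def preEnvelopeMap (f : A →⋆ₙₐ[ℂ] B) : NormedAddGroupHom (PreEnvelope A) (PreEnvelope B) where
  toFun := f
  map_add' a b := map_add f a b
  bound' := ⟨1, fun a => by
    rw [one_mul]
    exact universalSeminorm_map_le f a⟩

lemma preEnvelopeMap_mul (f : A →⋆ₙₐ[ℂ] B) (a b : PreEnvelope A) :
    preEnvelopeMap f (a * b) = preEnvelopeMap f a * preEnvelopeMap f b := map_mul f a b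

lemma preEnvelopeMap_smul (f : A →⋆ₙₐ[ℂ] B) (c : ℂ) (a : PreEnvelope A) :
    preEnvelopeMap f (c • a) = c • preEnvelopeMap f a := map_smul f c a

lemma preEnvelopeMap_star (f : A →⋆ₙₐ[ℂ] B) (a : PreEnvelope A) :
    preEnvelopeMap f (star a) = star (preEnvelopeMap f a) := map_star f a

/-- The continuous extension of a *-homomorphism to the universal enveloping C*-algebras. -/
def envelopeMapFun (f : A →⋆ₙₐ[ℂ] B) : CStarEnvelope A → CStarEnvelope B :=
  UniformSpace.Completion.map (preEnvelopeMap f)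

lemma continuous_envelopeMapFun (f : A →⋆ₙₐ[ℂ] B) : Continuous (envelopeMapFun f) :=
  UniformSpace.Completion.continuous_map

lemma envelopeMapFun_coe (f : A →⋆ₙₐ[ℂ] B) (a : PreEnvelope A) :
    envelopeMapFun f (CStarEnvelope.coe a) = CStarEnvelope.coe (preEnvelopeMap f a) :=
  UniformSpace.Completion.map_coe (preEnvelopeMap f).uniformContinuous a

lemma envelopeMapFun_smul (f : A →⋆ₙₐ[ℂ] B) (c : ℂ) : ∀ a : CStarEnvelope A,
    envelopeMapFun f (c • a) = c • envelopeMapFun f a :=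
  have hf := continuous_envelopeMapFun f
  CStarEnvelope.induction (isClosed_eq (hf.comp (continuous_id.const_smul c)) (hf.const_smul c))
    fun a => by
      rw [← CStarEnvelope.coe_smul, envelopeMapFun_coe, envelopeMapFun_coe, preEnvelopeMap_smul,
        CStarEnvelope.coe_smul]

lemma envelopeMapFun_add (f : A →⋆ₙₐ[ℂ] B) : ∀ a b : CStarEnvelope A,
    envelopeMapFun f (a + b) = envelopeMapFun f a + envelopeMapFun f b :=
  have hf := continuous_envelopeMapFun f
  CStarEnvelope.induction₂ (isClosed_eq (by fun_prop) (by fun_prop)) fun a b => by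
    rw [← CStarEnvelope.coe_add, envelopeMapFun_coe, envelopeMapFun_coe, envelopeMapFun_coe,
      map_add, CStarEnvelope.coe_add]

lemma envelopeMapFun_mul (f : A →⋆ₙₐ[ℂ] B) : ∀ a b : CStarEnvelope A,
    envelopeMapFun f (a * b) = envelopeMapFun f a * envelopeMapFun f b :=
  have hf := continuous_envelopeMapFun f
  CStarEnvelope.induction₂ (isClosed_eq (by fun_prop) (by fun_prop)) fun a b => by
    rw [← CStarEnvelope.coe_mul, envelopeMapFun_coe, envelopeMapFun_coe, envelopeMapFun_coe,
      preEnvelopeMap_mul, CStarEnvelope.coe_mul]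

lemma envelopeMapFun_star (f : A →⋆ₙₐ[ℂ] B) : ∀ a : CStarEnvelope A,
    envelopeMapFun f (star a) = star (envelopeMapFun f a) :=
  have hf := continuous_envelopeMapFun f
  CStarEnvelope.induction (isClosed_eq (by fun_prop) (by fun_prop)) fun a => by
    rw [← CStarEnvelope.coe_star, envelopeMapFun_coe, envelopeMapFun_coe, preEnvelopeMap_star,
      CStarEnvelope.coe_star]

/-- The homomorphism of universal enveloping C*-algebras induced by a *-homomorphism. -/
def envelopeMap (f : A →⋆ₙₐ[ℂ] B) : CStarEnvelope A →⋆ₙₐ[ℂ] CStarEnvelope B where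
  toFun := envelopeMapFun f
  map_smul' := envelopeMapFun_smul f
  map_zero' := by
    rw [← CStarEnvelope.coe_zero, envelopeMapFun_coe, map_zero, CStarEnvelope.coe_zero]
  map_add' := envelopeMapFun_add f
  map_mul' := envelopeMapFun_mul f
  map_star' := envelopeMapFun_star f

lemma envelopeMap_toEnvelope (f : A →⋆ₙₐ[ℂ] B) (a : A) :
    envelopeMap f (toEnvelope A a) = toEnvelope B (f a) :=
  envelopeMapFun_coe f a

open scoped CStarAlgebra in
/-- *-homomorphisms from a universal enveloping C*-algebra to a C*-algebra are determined by their
restriction to the original *-algebra. -/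
lemma envelope_hom_ext {C : Type*} [NonUnitalCStarAlgebra C] {φ ψ : CStarEnvelope A →⋆ₙₐ[ℂ] C}
    (h : ∀ a, φ (toEnvelope A a) = ψ (toEnvelope A a)) : φ = ψ := by
  apply NonUnitalStarAlgHom.ext
  -- *-homomorphisms between C*-algebras are automatically continuous, so agreement on the dense
  -- image of `A` suffices.
  exact CStarEnvelope.induction (isClosed_eq (map_continuous φ) (map_continuous ψ)) h

end EnvelopeMap

/-! ### The contravariant functor and its uniqueness. -/

/-- Homomorphisms induced by the morphisms of a subcategory of `CRG` are unique and give rise to a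
unique functor on universal enveloping C*-algebras. -/
theorem existsUnique_envelope_functor (W : MorphismProperty DGraph.{u, v}) [W.IsMultiplicative]
    (hW : ∀ {E F : DGraph.{u, v}} (R : E ⟶ F), W R → RelMorphism.IsCRG R)
    (I : ∀ E : DGraph.{u, v}, StarIdeal (FreeAlg E))
    (hI : ∀ E x, CohnRel E x → x ∈ (I E).carrier) [∀ E, HasEnvelope (I E).Quotient]
    (hex : ∀ {E F : DGraph.{u, v}} (R : E ⟶ F), W R →
      ∃ ρ : (I F).Quotient →⋆ₙₐ[ℂ] (I E).Quotient, IsInduced R ρ) :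
    (∀ (E F : WideSubcategory W) (R : E ⟶ F),
        ∃! ρ : (I F.obj).Quotient →⋆ₙₐ[ℂ] (I E.obj).Quotient, IsInduced R.hom ρ) ∧
      ∃! T : (WideSubcategory W)ᵒᵖ ⥤ CStarAlg.{max u v},
        ∃ φ : ∀ ⦃E F : WideSubcategory W⦄, (E ⟶ F) →
            (CStarEnvelope (I F.obj).Quotient →⋆ₙₐ[ℂ] CStarEnvelope (I E.obj).Quotient),
          T.toPrefunctor =
            { obj := fun E => ⟨CStarEnvelope (I E.unop.obj).Quotient⟩, map := fun R => φ R.unop } ∧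
          ∀ (E F : WideSubcategory W) (R : E ⟶ F)
            (ρ : (I F.obj).Quotient →⋆ₙₐ[ℂ] (I E.obj).Quotient), IsInduced R.hom ρ →
              ∀ a : (I F.obj).Quotient,
                φ R (toEnvelope (I F.obj).Quotient a) = toEnvelope (I E.obj).Quotient (ρ a) := by
  choose ρ hρ using fun (E F : WideSubcategory W) (R : E ⟶ F) => hex R.hom R.property
  refine ⟨fun E F R => ⟨ρ E F R, hρ E F R, fun σ hσ => IsInduced.eq hσ (hρ E F R)⟩, ?_⟩
  -- Both functor laws hold already for the *-algebras, by uniqueness of induced homomorphisms;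
  -- density then transfers them to the envelopes.
  have hid : ∀ E, ρ E E (𝟙 E) = NonUnitalStarAlgHom.id ℂ _ := fun E =>
    IsInduced.eq (hρ E E (𝟙 E)) isInduced_id
  have hcomp : ∀ (E F G : WideSubcategory W) (R : E ⟶ F) (S : F ⟶ G),
      ρ E G (R ≫ S) = (ρ E F R).comp (ρ F G S) := fun E F G R S =>
    IsInduced.eq (hρ E G (R ≫ S)) (IsInduced.comp (hI _) (hI _) (hW _ R.property)
      (hW _ S.property) (hρ E F R) (hρ F G S))
  let T : (WideSubcategory W)ᵒᵖ ⥤ CStarAlg.{max u v} :=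
    { obj := fun E => ⟨CStarEnvelope (I E.unop.obj).Quotient⟩
      map := fun R => envelopeMap (ρ _ _ R.unop)
      map_id := fun E => envelope_hom_ext fun a => by
        rw [envelopeMap_toEnvelope]
        exact congrArg (toEnvelope _) (DFunLike.congr_fun (hid E.unop) a)
      map_comp := fun {E F G} R S => envelope_hom_ext fun a => by
        rw [envelopeMap_toEnvelope]
        refine (congrArg (toEnvelope _) (DFunLike.congr_fun
          (hcomp _ _ _ S.unop R.unop) a)).trans ?_
        refine (envelopeMap_toEnvelope (ρ _ _ S.unop) _).symm.trans ?_
        exact congrArg (envelopeMap (ρ _ _ S.unop))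
          (envelopeMap_toEnvelope (ρ _ _ R.unop) a).symm }
  refine ⟨T, ⟨fun E F R => envelopeMap (ρ E F R), rfl, fun E F R σ hσ a => ?_⟩, ?_⟩
  · rw [IsInduced.eq hσ (hρ E F R)]
    exact envelopeMap_toEnvelope _ a
  · rintro T' ⟨φ, hT', hφ⟩
    -- Compatibility fixes `φ R` on the dense image of the *-algebra, hence everywhere.
    have h : φ = fun E F R => envelopeMap (ρ E F R) := by
      funext E F R
      exact envelope_hom_ext fun a =>
        (hφ E F R _ (hρ E F R) a).trans (envelopeMap_toEnvelope _ a).symm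
    subst h
    -- Since `φ` is typed on the envelopes themselves, objects and morphisms are compared in one
    -- equality of prefunctors, with no transport along equalities of objects. The functor laws are
    -- propositions, so this equality identifies the functors.
    have hpre : T'.toPrefunctor = T.toPrefunctor := hT'
    cases T'
    cases hpre
    rfl

end GraphRel

end

/-- Toeplitz graph C*-algebras define a contravariant functor on `CRG` and graph C*-algebras define
a contravariant functor on `ARG`. -/
theorem corollary6p6 :
    -- `R_C^*` exists and is unique, and it induces a unique functor on Toeplitz graph C*-algebras
    ((∀ (E F : CRG.{u, v}) (R : E ⟶ F),
        ∃! ρ : CohnPathAlgebra F.obj →⋆ₙₐ[ℂ] CohnPathAlgebra E.obj, IsInduced R.hom ρ) ∧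
      ∃! T : CRG.{u, v}ᵒᵖ ⥤ CStarAlg.{max u v},
        ∃ φ : ∀ ⦃E F : CRG.{u, v}⦄, (E ⟶ F) → (ToeplitzCStar F.obj →⋆ₙₐ[ℂ] ToeplitzCStar E.obj),
          T.toPrefunctor = { obj := fun E => ⟨ToeplitzCStar E.unop.obj⟩, map := fun R => φ R.unop } ∧
          ∀ (E F : CRG.{u, v}) (R : E ⟶ F)
            (ρ : CohnPathAlgebra F.obj →⋆ₙₐ[ℂ] CohnPathAlgebra E.obj), IsInduced R.hom ρ →
              ∀ a : CohnPathAlgebra F.obj,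
                φ R (toEnvelope (CohnPathAlgebra F.obj) a) =
                  toEnvelope (CohnPathAlgebra E.obj) (ρ a)) ∧
    -- `R_L^*` exists and is unique, and it induces a unique functor on graph C*-algebras
    ((∀ (E F : ARG.{u, v}) (R : E ⟶ F),
        ∃! ρ : LeavittPathAlgebra F.obj →⋆ₙₐ[ℂ] LeavittPathAlgebra E.obj, IsInduced R.hom ρ) ∧
      ∃! T : ARG.{u, v}ᵒᵖ ⥤ CStarAlg.{max u v},
        ∃ φ : ∀ ⦃E F : ARG.{u, v}⦄, (E ⟶ F) → (GraphCStar F.obj →⋆ₙₐ[ℂ] GraphCStar E.obj),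
          T.toPrefunctor = { obj := fun E => ⟨GraphCStar E.unop.obj⟩, map := fun R => φ R.unop } ∧
          ∀ (E F : ARG.{u, v}) (R : E ⟶ F)
            (ρ : LeavittPathAlgebra F.obj →⋆ₙₐ[ℂ] LeavittPathAlgebra E.obj), IsInduced R.hom ρ →
              ∀ a : LeavittPathAlgebra F.obj,
                φ R (toEnvelope (LeavittPathAlgebra F.obj) a) =
                  toEnvelope (LeavittPathAlgebra E.obj) (ρ a)) :=
  ⟨existsUnique_envelope_functor isCRG (fun _ h => h) cohnIdeal (fun _ _ => mem_cohnIdeal)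
      (fun _ h => exists_isInduced_cohn h),
    existsUnique_envelope_functor isAdmissible (fun _ h => RelMorphism.IsAdmissible.toIsCRG h)
      leavittIdeal (fun _ x h => mem_leavittIdeal (.cohn x h))
      (fun _ h => exists_isInduced_leavitt h)⟩
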